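/- Let $m=2d$ be even, let $\mathfrak F$ be the symmetric Fock space over $L^2(\mathbb R_+,\mathbb C^{d})$, and let $W(t)=(W_1(t),\dots,W_m(t))^{\mathsf T}$, $t\ge 0$, be the $m$-channel quantum Wiener process of self-adjoint operators on $\mathfrak F$, with $W(0)=\mathcal I$ (the vector of $m$ copies of the identity operator) and $$[W(s),W(t)^{\mathsf T}]=2i\min(s,t)J,\qquad J=\begin{bmatrix}0&1\\-1&0\end{bmatrix}\otimes I_{m/2}.$$ Fix $T>0$ and set $$\omega_k=\tfrac{\pi}{T}\left(k+\tfrac12\right),\qquad f_k(t)=\sqrt{\tfrac2T}\,\sin(\omega_k t),\qquad w_k=\omega_k\int_0^T f_k(t)\,(W(t)-\mathcal I)\,dt,\qquad k=0,1,2,\dots$$ Let $\rho$ be a density operator on $\mathfrak F$, write $\mathbf E\,\xi=\operatorname{Tr}(\rho\,\xi)$, and suppose that $W$ is in the vacuum state on $[0,T]$, in the sense that $$\mathbf E\, e^{i\int_0^T f(t)^{\mathsf T}dW(t)}=e^{-\frac12\int_0^T|f(t)|^2dt}\qquad\text{for all } f\in L^2([0,T],\mathbb R^m).$$ Then the vectors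 $w_0,w_1,w_2,\dots$ are statistically independent: the von Neumann algebras $\mathcal A_k$ generated by the operators $e^{iu^{\mathsf T}w_k}$, $u\in\mathbb R^m$, commute with each other, and $\mathbf E(A_0A_1\cdots A_N)=\prod_{k=0}^N\mathbf E A_k$ for all $N\ge 0$ and all $A_k\in\mathcal A_k$. Moreover, for every $N\ge0$ the vectors $w_0,\dots,w_N$ are in a joint Gaussian quantum state with zero mean and covariance matrix $I_{N+1}\otimes\Omega$, where $\Omega=I_m+iJ$; that is, they satisfy the canonical commutation relations $[w_j,w_k^{\mathsf T}]=2i\delta_{jk}J$ in Weyl form and $$\mathbf E\, e^{i\sum_{k=0}^N u_k^{\mathsf T}w_k}=e^{-\frac12\sum_{k=0}^N|u_k|^2}\qquad\text{for all } u_0,\dots,u_N\in\mathbb R^m.$$ In particular, $$\mathbf E\,w_k=0,\qquad \mathbf E(w_jw_k^{\mathsf T})=\delta_{jk}\,\Omega,\qquad j,k=0,1,2,\dots$$ -/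

import Mathlib

open scoped InnerProductSpace Kronecker ComplexOrder
open MeasureTheory

noncomputable section

namespace QKL

/-! ### Unbounded operators and their exponentials -/

section Operators

variable {H : Type} [NormedAddCommGroup H] [InnerProductSpace ℂ H]

/-- A bounded operator regarded as an everywhere defined partial operator. -/
def ofBounded (X : H →L[ℂ] H) : H →ₗ.[ℂ] H :=
  (X : H →ₗ[ℂ] H).toPMap ⊤

/-- The operator product `A B` with its natural domain `{x ∈ dom B | B x ∈ dom A}`. -/
def opMul (A B : H →ₗ.[ℂ] H) : H →ₗ.[ℂ] H where
  domain := (A.domain.comap B.toFun).map B.domain.subtype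
  toFun :=
    { toFun := fun x => A ⟨B ⟨x, by
          obtain ⟨y, -, hy⟩ := x.2
          rw [← hy]; exact y.2⟩, by
          obtain ⟨y, hy, hyx⟩ := x.2
          have h : (⟨(x : H), by rw [← hyx]; exact y.2⟩ : B.domain) = y :=
            Subtype.ext hyx.symm
          rw [h]
          exact hy⟩
      map_add' := fun x y => by
        rw [← A.map_add]
        congr 1
        apply Subtype.ext
        change B _ = B _ + B _
        rw [← B.map_add]
        rfl
      map_smul' := fun c x => by
        rw [RingHom.id_apply, ← A.map_smul]
        congr 1
        apply Subtype.ext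
        change B _ = c • B _
        rw [← B.map_smul]
        rfl }

/-- Strongly continuous one-parameter unitary groups. -/
structure IsUnitaryGroup (U : ℝ → H →L[ℂ] H) : Prop where
  zero : U 0 = 1
  add : ∀ s t, U (s + t) = U s * U t
  norm_map : ∀ s x, ‖U s x‖ = ‖x‖
  continuous : ∀ x, Continuous fun s => U s x

/-- The (Stone) generator `A` of `U s = exp (i s A)`: the domain consists of the vectors whose
orbit is differentiable at `0`, and `A x = -i (d/ds) U s x` at `s = 0`. -/
def generator (U : ℝ → H →L[ℂ] H) : H →ₗ.[ℂ] H where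
  domain :=
    { carrier := {x | DifferentiableAt ℝ (fun s => U s x) 0}
      add_mem' := fun {x y} hx hy => by
        have h := DifferentiableAt.fun_add hx hy
        simpa only [Set.mem_ofPred_eq, map_add] using h
      zero_mem' := by simp
      smul_mem' := fun c x hx => by
        have h := DifferentiableAt.fun_const_smul hx c
        simpa only [Set.mem_ofPred_eq, map_smul] using h }
  toFun :=
    { toFun := fun x => (-Complex.I) • deriv (fun s => U s (x : H)) 0
      map_add' := fun x y => by
        have h := deriv_fun_add (f := fun s => U s (x : H)) (g := fun s => U s (y : H)) (x := 0)
          x.2 y.2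
        simp only [Submodule.coe_add, map_add, h, smul_add]
      map_smul' := fun c x => by
        have h := deriv_fun_const_smul (f := fun s => U s (x : H)) (x := 0) c x.2
        simp only [SetLike.val_smul, map_smul, h, RingHom.id_apply]
        rw [smul_comm] }

open Classical in
/-- `exp (i A)` for a self-adjoint operator `A`, that is, for the generator of a (unique) strongly
continuous unitary group. It is set to `0` for an operator that is not of this kind. -/
def expI (A : H →ₗ.[ℂ] H) : H →L[ℂ] H :=
  if h : ∃ U : ℝ → H →L[ℂ] H, IsUnitaryGroup U ∧ generator U = A then h.choose 1 else 0

/-- The real linear combination `∑ a, u a ξ a` of finitely many self-adjoint operators: the closure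
of the sum on the intersection of the domains. -/
def linComb {ι : Type} [Fintype ι] (u : ι → ℝ) (ξ : ι → H →ₗ.[ℂ] H) : H →ₗ.[ℂ] H :=
  (∑ a, (u a : ℂ) • ξ a).closure

open Classical in
/-- `A x`, extended by `0` outside of the domain of `A`. -/
def applyOrZero (A : H →ₗ.[ℂ] H) (x : H) : H :=
  if h : x ∈ A.domain then A ⟨x, h⟩ else 0

lemma applyOrZero_add (A : H →ₗ.[ℂ] H) {x y : H} (hx : x ∈ A.domain) (hy : y ∈ A.domain) :
    applyOrZero A (x + y) = applyOrZero A x + applyOrZero A y := by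
  simp only [applyOrZero, hx, hy, A.domain.add_mem hx hy, dif_pos]
  rw [← A.map_add]
  rfl

lemma applyOrZero_smul (A : H →ₗ.[ℂ] H) (c : ℂ) {x : H} (hx : x ∈ A.domain) :
    applyOrZero A (c • x) = c • applyOrZero A x := by
  simp only [applyOrZero, hx, A.domain.smul_mem c hx, dif_pos]
  rw [← A.map_smul]
  rfl

/-- The strong integral `∫ t in 0..T, φ t A t` of an operator-valued function, initially defined on
the vectors `x` which lie in the domain of every `A t`, `0 ≤ t ≤ T`, and for which
`t ↦ φ t A t x` is (Bochner) integrable; the operator is then the closure. -/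
def strongIntegral (T : ℝ) (φ : ℝ → ℝ) (A : ℝ → H →ₗ.[ℂ] H) : H →ₗ.[ℂ] H :=
  LinearPMap.closure
  { domain :=
      { carrier := {x | (∀ t ∈ Set.Icc 0 T, x ∈ (A t).domain) ∧
          IntegrableOn (fun t => φ t • applyOrZero (A t) x) (Set.Icc 0 T)}
        add_mem' := fun {x y} hx hy => by
          refine ⟨fun t ht => (A t).domain.add_mem (hx.1 t ht) (hy.1 t ht), ?_⟩
          refine (hx.2.add hy.2).congr_fun (fun t ht => ?_) measurableSet_Icc
          simp only [Pi.add_apply, applyOrZero_add (A t) (hx.1 t ht) (hy.1 t ht), smul_add]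
        zero_mem' := by
          refine ⟨fun t _ => (A t).domain.zero_mem, ?_⟩
          have h : (fun t => φ t • applyOrZero (A t) (0 : H)) = fun _ => 0 := by
            funext t
            have h0 := applyOrZero_smul (A t) 0 (A t).domain.zero_mem
            simp only [zero_smul] at h0
            simp [h0]
          rw [h]
          exact integrableOn_zero
        smul_mem' := fun c x hx => by
          refine ⟨fun t ht => (A t).domain.smul_mem c (hx.1 t ht), ?_⟩
          have h := Integrable.smul c hx.2
          refine IntegrableOn.congr_fun h (fun t ht => ?_) measurableSet_Icc
          simp only [Pi.smul_apply, applyOrZero_smul (A t) c (hx.1 t ht)]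
          rw [smul_comm] }
    toFun :=
      { toFun := fun x => ∫ t in Set.Icc 0 T, φ t • applyOrZero (A t) (x : H)
        map_add' := fun x y => by
          rw [← integral_add x.2.2 y.2.2]
          refine setIntegral_congr_fun measurableSet_Icc (fun t ht => ?_)
          simp only [Submodule.coe_add, applyOrZero_add (A t) (x.2.1 t ht) (y.2.1 t ht), smul_add]
        map_smul' := fun c x => by
          rw [RingHom.id_apply, ← integral_smul]
          refine setIntegral_congr_fun measurableSet_Icc (fun t ht => ?_)
          simp only [SetLike.val_smul, applyOrZero_smul (A t) c (x.2.1 t ht)]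
          rw [smul_comm] } }

/-! ### Quantum states and expectations -/

/-- `Tr (ξ ρ) = c` for a bounded operator `ρ` with range in the domain of `ξ`: the diagonal series
of `ξ ρ` converges to `c` unconditionally in every orthonormal basis. -/
def HasExpectation (ρ : H →L[ℂ] H) (ξ : H →ₗ.[ℂ] H) (c : ℂ) : Prop :=
  ∃ hρ : ∀ x, ρ x ∈ ξ.domain, ∀ (ι : Type) (b : HilbertBasis ι ℂ H),
    HasSum (fun i => ⟪b i, ξ ⟨ρ (b i), hρ (b i)⟩⟫_ℂ) c

/-- Density operators: positive operators of trace one. -/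
structure IsDensityOperator [CompleteSpace H] (ρ : H →L[ℂ] H) : Prop where
  isPositive : ρ.IsPositive
  trace_eq_one : HasExpectation ρ (ofBounded 1) 1

/-- The quantum variables `ξ a` are in a joint Gaussian state with mean vector `μ` and (complex,
Hermitian) covariance matrix `Γ`: they satisfy the Weyl form of the canonical commutation relations
`[ξ a, ξ b] = 2 i Im (Γ a b)`, and their joint quasi-characteristic function is
`exp (i uᵀ μ - uᵀ Γ u / 2)`. -/
structure IsJointlyGaussian {ι : Type} [Fintype ι] (ρ : H →L[ℂ] H) (ξ : ι → H →ₗ.[ℂ] H)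
    (μ : ι → ℝ) (Γ : Matrix ι ι ℂ) : Prop where
  weyl_ccr : ∀ u v : ι → ℝ, expI (linComb u ξ) * expI (linComb v ξ) =
    Complex.exp (-Complex.I * ∑ a, ∑ b, (u a : ℂ) * ((Γ a b).im : ℂ) * (v b : ℂ)) •
      expI (linComb (u + v) ξ)
  qcf : ∀ u : ι → ℝ, HasExpectation ρ (ofBounded (expI (linComb u ξ)))
    (Complex.exp (Complex.I * (∑ a, (u a : ℂ) * (μ a : ℂ)) -
      1 / 2 * ∑ a, ∑ b, (u a : ℂ) * Γ a b * (u b : ℂ)))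

/-- The von Neumann algebra (bicommutant) generated by the unitary operators `exp (i uᵀ ξ)`. -/
def generatedAlgebra {ι : Type} [Fintype ι] (ξ : ι → H →ₗ.[ℂ] H) : Set (H →L[ℂ] H) :=
  Set.centralizer (Set.centralizer (Set.range fun u : ι → ℝ => expI (linComb u ξ)))

/-- Statistical independence of a sequence of vectors of quantum variables: the generated
von Neumann algebras commute pairwise, and the state factorizes over them. -/
def StatIndependent {ι : Type} [Fintype ι] (ρ : H →L[ℂ] H) (ξ : ℕ → ι → H →ₗ.[ℂ] H) : Prop :=
  (∀ j k, j ≠ k → ∀ A ∈ generatedAlgebra (ξ j), ∀ B ∈ generatedAlgebra (ξ k), A * B = B * A) ∧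
  ∀ (N : ℕ) (A : ℕ → H →L[ℂ] H), (∀ k, A k ∈ generatedAlgebra (ξ k)) →
    ∃ c : ℕ → ℂ, (∀ k, HasExpectation ρ (ofBounded (A k)) (c k)) ∧
      HasExpectation ρ (ofBounded ((List.range N).map A).prod) (∏ k ∈ Finset.range N, c k)

end Operators

/-! ### The symmetric Fock space through exponential vectors -/

section FockSpace

/-- The kernel `(u, v) ↦ exp ⟪u, v⟫`. -/
def expKernel (K : Type) [NormedAddCommGroup K] [InnerProductSpace ℂ K] :
    Matrix K K (ℂ →L[ℂ] ℂ) :=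
  Matrix.of fun u v => Complex.exp ⟪u, v⟫_ℂ • (1 : ℂ →L[ℂ] ℂ)

variable {K : Type} [NormedAddCommGroup K] [InnerProductSpace ℂ K]

lemma posSemidef_exp_inner {ι : Type} (x : ι → K) :
    (Matrix.of fun i j => Complex.exp ⟪x i, x j⟫_ℂ).PosSemidef := by
  have hg : (Matrix.of fun i j => ⟪x i, x j⟫_ℂ).PosSemidef := by
    refine ⟨?_, fun f => ?_⟩
    · ext i j
      simp
    · have h : (f.sum fun i xi => f.sum fun j xj =>
          star xi * (Matrix.of fun i j => ⟪x i, x j⟫_ℂ) i j * xj) =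
          ⟪(f.sum fun i xi => xi • x i : K), (f.sum fun i xi => xi • x i : K)⟫_ℂ := by
        simp only [Finsupp.sum, Matrix.of_apply]
        rw [sum_inner]
        refine Finset.sum_congr rfl fun i _ => ?_
        rw [inner_sum]
        refine Finset.sum_congr rfl fun j _ => ?_
        rw [inner_smul_left, inner_smul_right, RCLike.star_def]
        ring
      rw [h, inner_self_eq_norm_sq_to_K]
      positivity
  have hp : ∀ n : ℕ, (Matrix.of fun i j => ⟪x i, x j⟫_ℂ ^ n).PosSemidef := by
    intro n
    induction n with
    | zero =>
      refine ⟨?_, fun f => ?_⟩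
      · ext i j
        simp
      · have h : (f.sum fun i xi => f.sum fun j xj =>
            star xi * (Matrix.of fun i j => ⟪x i, x j⟫_ℂ ^ 0) i j * xj) =
            star (f.sum fun _ xi => xi) * (f.sum fun _ xi => xi) := by
          simp only [Finsupp.sum, pow_zero, Matrix.of_apply, star_sum, Finset.sum_mul_sum, mul_one]
        rw [h]
        exact star_mul_self_nonneg _
    | succ n ih => exact ih.hadamard hg
  refine ⟨?_, fun f => ?_⟩
  · ext i j
    simp [← Complex.exp_conj]
  · have hs : HasSum (fun n : ℕ => (n.factorial : ℂ)⁻¹ * f.sum fun i xi => f.sum fun j xj =>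
        star xi * ⟪x i, x j⟫_ℂ ^ n * xj)
        (f.sum fun i xi => f.sum fun j xj => star xi * Complex.exp ⟪x i, x j⟫_ℂ * xj) := by
      simp only [Finsupp.sum, Finset.mul_sum]
      refine hasSum_sum fun i _ => hasSum_sum fun j _ => ?_
      have h := NormedSpace.expSeries_div_hasSum_exp (𝔸 := ℂ) ⟪x i, x j⟫_ℂ
      rw [← Complex.exp_eq_exp_ℂ] at h
      have e : (fun n : ℕ => (n.factorial : ℂ)⁻¹ * (star (f i) * ⟪x i, x j⟫_ℂ ^ n * f j)) =
          fun n : ℕ => star (f i) * (⟪x i, x j⟫_ℂ ^ n / (n.factorial : ℂ)) * f j := by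
        funext n
        rw [div_eq_mul_inv]
        ring
      rw [e]
      exact (h.mul_left (star (f i))).mul_right (f j)
    exact hs.nonneg fun n => mul_nonneg (by positivity) ((hp n).2 f)

instance instFactExpKernel : Fact (expKernel K).PosSemidef := by
  constructor
  have hK : (expKernel K).IsHermitian := by
    ext1 u v
    simp only [Matrix.conjTranspose_apply, expKernel, Matrix.of_apply, star_smul, star_one,
      RCLike.star_def, ← Complex.exp_conj, inner_conj_symm]
  have h := (RKHS.posSemidef_tfae (K := expKernel K)).out 0 2
  refine h.mpr ⟨hK, fun f => ?_⟩
  have h1 := (posSemidef_exp_inner (K := K) id).2 f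
  have h2 := (RCLike.nonneg_iff.mp h1).1
  convert h2 using 2
  refine Finsupp.sum_congr fun u _ => Finsupp.sum_congr fun v _ => ?_
  simp only [expKernel, Matrix.of_apply, smul_apply, id, RCLike.star_def, RCLike.inner_apply,
    one_apply_eq_self, smul_eq_mul, map_mul, ← Complex.exp_conj, inner_conj_symm]
  ring

variable (K) in
/-- The symmetric Fock space over `K`: the Hilbert space generated by the exponential vectors
`expVec u`, `u ∈ K`, with `⟪expVec u, expVec v⟫ = exp ⟪u, v⟫`. -/
abbrev Fock : Type := RKHS.OfKernel (expKernel K)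

/-- Exponential (coherent) vectors. -/
def expVec (u : K) : Fock K := RKHS.kerFun (Fock K) u 1

lemma inner_expVec (u v : K) : ⟪expVec u, expVec v⟫_ℂ = Complex.exp ⟪u, v⟫_ℂ := by
  have h := RKHS.kernel_inner (Fock K) v u 1 1
  rw [expVec, expVec, ← h, RKHS.OfKernel.kernel_ofKernel]
  simp [expKernel, ← Complex.exp_conj]

lemma denseRange_expVec :
    DenseRange (Finsupp.linearCombination ℂ (expVec : K → Fock K)) := by
  have h := RKHS.kerFun_dense (Fock K)
  have e : Submodule.span ℂ {RKHS.kerFun (Fock K) x v | (x) (v)} =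
      LinearMap.range (Finsupp.linearCombination ℂ (expVec : K → Fock K)) := by
    rw [Finsupp.range_linearCombination]
    apply le_antisymm
    · refine Submodule.span_le.mpr ?_
      rintro _ ⟨x, v, rfl⟩
      have hv : RKHS.kerFun (Fock K) x v = v • expVec x := by
        rw [expVec, ← map_smul, smul_eq_mul, mul_one]
      rw [hv]
      exact Submodule.smul_mem _ _ (Submodule.subset_span ⟨x, rfl⟩)
    · refine Submodule.span_mono ?_
      rintro _ ⟨x, rfl⟩
      exact ⟨x, 1, rfl⟩
  rw [e] at h
  rw [DenseRange, dense_iff_closure_eq]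
  have h2 := congrArg (fun S : Submodule ℂ (Fock K) => (S : Set (Fock K))) h
  simpa only [LinearMap.coe_range, Submodule.topologicalClosure_coe, Submodule.top_coe] using h2

/-- The image of `expVec v` under the Weyl operator `W(u)`. -/
def weylVec (u v : K) : Fock K :=
  Complex.exp (-(‖u‖ ^ 2 : ℝ) / 2 - ⟪u, v⟫_ℂ) • expVec (u + v)

lemma inner_weylVec (u v w : K) :
    ⟪weylVec u v, weylVec u w⟫_ℂ = ⟪expVec v, expVec w⟫_ℂ := by
  simp only [weylVec, inner_smul_left, inner_smul_right, inner_expVec, ← Complex.exp_conj,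
    ← Complex.exp_add, inner_add_left, inner_add_right]
  congr 1
  have h : ⟪u, u⟫_ℂ = ((‖u‖ ^ 2 : ℝ) : ℂ) := by
    rw [inner_self_eq_norm_sq_to_K]
    norm_cast
  simp only [map_sub, map_neg, map_div₀, Complex.conj_ofReal, inner_conj_symm, h, map_ofNat]
  ring

lemma norm_linearCombination_weylVec (u : K) (f : K →₀ ℂ) :
    ‖Finsupp.linearCombination ℂ (weylVec u) f‖ =
      ‖Finsupp.linearCombination ℂ (expVec : K → Fock K) f‖ := by
  have h : ⟪Finsupp.linearCombination ℂ (weylVec u) f,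
      Finsupp.linearCombination ℂ (weylVec u) f⟫_ℂ =
      ⟪Finsupp.linearCombination ℂ (expVec : K → Fock K) f,
        Finsupp.linearCombination ℂ (expVec : K → Fock K) f⟫_ℂ := by
    simp only [Finsupp.linearCombination_apply, Finsupp.sum, sum_inner, inner_sum,
      inner_smul_left, inner_smul_right, inner_weylVec]
  rw [← sq_eq_sq₀ (norm_nonneg _) (norm_nonneg _), ← inner_self_eq_norm_sq (𝕜 := ℂ), h,
    inner_self_eq_norm_sq (𝕜 := ℂ)]

/-- The Weyl (displacement) operator, determined by its action on the exponential vectors: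
`W(u) expVec v = exp (-‖u‖² / 2 - ⟪u, v⟫) expVec (u + v)`. -/
def weyl (u : K) : Fock K →L[ℂ] Fock K :=
  (Finsupp.linearCombination ℂ (weylVec u)).extendOfNorm
    (Finsupp.linearCombination ℂ (expVec : K → Fock K))

lemma weyl_expVec (u v : K) :
    weyl u (expVec v) = Complex.exp (-(‖u‖ ^ 2 : ℝ) / 2 - ⟪u, v⟫_ℂ) • expVec (u + v) := by
  have h := LinearMap.extendOfNorm_eq (f := Finsupp.linearCombination ℂ (weylVec u))
    (e := Finsupp.linearCombination ℂ (expVec : K → Fock K)) denseRange_expVec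
    ⟨1, fun f => by rw [one_mul, norm_linearCombination_weylVec]⟩ (Finsupp.single v 1)
  rw [Finsupp.linearCombination_single, Finsupp.linearCombination_single, one_smul, one_smul] at h
  exact h

/-- The field operator `a(h) + a(h)*`, the self-adjoint operator with
`exp (i s (a(h) + a(h)*)) = W(i s h)`. -/
def fieldOp (h : K) : Fock K →ₗ.[ℂ] Fock K :=
  generator fun s => weyl (((s : ℂ) * Complex.I) • h)

end FockSpace

/-! ### The quantum Wiener process and its Karhunen-Loeve coefficients

The number of channels is `m = 2 d`. The channels are indexed by `Fin 2 × Fin d`: `(0, j)` are the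
position-type and `(1, j)` the momentum-type components. -/

section Wiener

/-- The matrix `[0, 1; -1, 0]`. -/
def bJ : Matrix (Fin 2) (Fin 2) ℝ := !![0, 1; -1, 0]

/-- The matrix `J = bJ ⊗ I`. -/
def J (d : ℕ) : Matrix (Fin 2 × Fin d) (Fin 2 × Fin d) ℝ :=
  bJ ⊗ₖ (1 : Matrix (Fin d) (Fin d) ℝ)

/-- The quantum Ito matrix `Ω = I + i J`. -/
def Omega (d : ℕ) : Matrix (Fin 2 × Fin d) (Fin 2 × Fin d) ℂ :=
  1 + Complex.I • (J d).map Complex.ofReal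

/-- The one-particle space `L²(ℝ₊, ℂᵈ)`. -/
abbrev OneParticle (d : ℕ) : Type :=
  Lp (EuclideanSpace ℂ (Fin d)) 2 (volume.restrict (Set.Ici (0 : ℝ)))

/-- The symmetric Fock space of `d` boson fields over the time half-line. -/
abbrev FieldSpace (d : ℕ) : Type := Fock (OneParticle d)

/-- The complex form of a vector in `ℝᵐ`, `m = 2 d`: with entries `f (0, j) + i f (1, j)`. -/
def complexForm {d : ℕ} (x : EuclideanSpace ℝ (Fin 2 × Fin d)) : EuclideanSpace ℂ (Fin d) :=
  WithLp.toLp 2 fun j => (x (0, j) : ℂ) + Complex.I * (x (1, j) : ℂ)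

open Classical in
/-- The one-particle vector of a square integrable function on the half-line with values
in `ℝᵐ` (and `0` if the function is not square integrable). -/
def testVec {d : ℕ} (f : ℝ → EuclideanSpace ℝ (Fin 2 × Fin d)) : OneParticle d :=
  if h : MemLp (fun t => complexForm (f t)) 2 (volume.restrict (Set.Ici (0 : ℝ))) then
    h.toLp else 0

/-- The quantum stochastic integral `∫ t in 0..T, (f t)ᵀ dW t` of a deterministic square integrable
function: the field operator of `f` on `[0, T]`. Its position-type components contribute
`A + A*` and its momentum-type components `i (A* - A)`, where `A`, `A*` are the annihilation and
creation processes. -/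
def wienerIntegral {d : ℕ} (T : ℝ) (f : ℝ → EuclideanSpace ℝ (Fin 2 × Fin d)) :
    FieldSpace d →ₗ.[ℂ] FieldSpace d :=
  fieldOp (testVec ((Set.Icc 0 T).indicator f))

/-- The identity operator. -/
def idOp (d : ℕ) : FieldSpace d →ₗ.[ℂ] FieldSpace d := ofBounded 1

/-- The component `W_a(t)`, `t ≥ 0`, of the quantum Wiener process, which starts at the identity
operator: `W_a(t) - I` is the field operator of the function `s ↦ e_a` on `[0, t]`. -/
def W {d : ℕ} (a : Fin 2 × Fin d) (t : ℝ) : FieldSpace d →ₗ.[ℂ] FieldSpace d :=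
  idOp d + wienerIntegral t fun _ => EuclideanSpace.single a (1 : ℝ)

/-- The quantum Wiener process is in the vacuum state on `[0, T]`: its quasi-characteristic
functional is `exp (-‖f‖² / 2)`. -/
def IsVacuum {d : ℕ} (T : ℝ) (ρ : FieldSpace d →L[ℂ] FieldSpace d) : Prop :=
  ∀ f : ℝ → EuclideanSpace ℝ (Fin 2 × Fin d), MemLp f 2 (volume.restrict (Set.Icc 0 T)) →
    HasExpectation ρ (ofBounded (expI (wienerIntegral T f)))
      (Complex.exp (-(1 / 2) * ((∫ t in Set.Icc 0 T, ‖f t‖ ^ 2 : ℝ) : ℂ)))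

/-- The frequencies `ω_k = (π / T) (k + 1/2)`. -/
def omega (T : ℝ) (k : ℕ) : ℝ := Real.pi / T * (k + 1 / 2)

/-- The eigenfunctions `f_k(t) = √(2 / T) sin (ω_k t)`. -/
def eigenfun (T : ℝ) (k : ℕ) (t : ℝ) : ℝ := √(2 / T) * Real.sin (omega T k * t)

/-- The Karhunen-Loeve coefficients `w_k = ω_k ∫ t in 0..T, f_k(t) (W(t) - I)`, componentwise. -/
def klCoeff {d : ℕ} (T : ℝ) (k : ℕ) (a : Fin 2 × Fin d) : FieldSpace d →ₗ.[ℂ] FieldSpace d :=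
  (omega T k : ℂ) • strongIntegral T (eigenfun T k) fun t => W a t - idOp d

end Wiener

end QKL

end

open scoped InnerProductSpace Kronecker ComplexOrder
open MeasureTheory

noncomputable section

namespace QKL

/-! ### Unitary groups and their generators -/

section UnitaryGroups

open Filter Topology

variable {H : Type} [NormedAddCommGroup H] [InnerProductSpace ℂ H]

/-! Integration by parts turns the coefficients into Wiener integrals. Since `W a t - I` is the
field operator of the indicator of `[0, t]` in channel `a`, Fubini gives weight `∫ t in s..T, f_k t`
at time `s`. Times `ω_k` this is `√(2/T) cos (ω_k s)`, because `cos (ω_k T) = 0`. So each `klCoeff`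
is the field operator of a one-particle vector `klVec` (`klCoeff_eq_fieldOp`). These cosines are
orthonormal on `[0, T]`, hence the Gram matrix of the `klVec` is `δ_jk Ω` (`inner_klVec`). The Weyl
relation `W(u) W(v) = exp (-i Im ⟪u, v⟫) W(u + v)` and the vacuum functional `exp (-‖u‖²/2)` then
give the commutation relations, the Gaussian law and the factorization over orthogonal vectors.

Sums, multiples and strong integrals of unbounded field operators are identified by a core argument
(`closure_eq_generator`): the span of the exponential vectors is dense and invariant under the Weyl
group, so any operator defined there and formally adjoint to the generator there has the generator
as its closure.

The state `ρ` is vacuum only on `[0, T]` and is not assumed pure. It is purified: with `Q = √ρ`, the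
vectors `Q b_i` form a vector `ψ` of a Hilbert sum of copies of the Fock space, and `Tr (ρ X)`
becomes `⟪ψ, amplify X ψ⟫`. The vacuum hypothesis fixes the Gram matrix of the vectors `amplify
(weyl u) ψ` for `u` in the subspace `L` of vectors supported in `[0, T]`. Hence the Fock space of
`L` embeds isometrically, vacuum to `ψ`, and intertwines Weyl operators (`vacuumEmbedding`). First
and second moments, including the domain conditions, are computed in that Fock space and carried
over.

Factorization passes from Weyl operators to von Neumann algebras by the density step of the
bicommutant theorem (`amplify_mem_closure_span`), replacing one factor at a time
(`inner_amplify_prod`). -/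

lemma mem_generator_graph {U : ℝ → H →L[ℂ] H} {x z : H} :
    (x, z) ∈ (generator U).graph ↔ HasDerivAt (fun s => U s x) (Complex.I • z) 0 := by
  rw [LinearPMap.mem_graph_iff]
  constructor
  · rintro ⟨⟨y, hy⟩, rfl, hz⟩
    have h : HasDerivAt (fun s => U s y) (deriv (fun s => U s y) 0) 0 :=
      DifferentiableAt.hasDerivAt hy
    have hz' : (-Complex.I) • deriv (fun s => U s y) 0 = z := hz
    rw [← hz', smul_smul]
    simpa using h
  · intro h
    refine ⟨⟨x, h.differentiableAt⟩, rfl, ?_⟩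
    change (-Complex.I) • deriv (fun s => U s x) 0 = z
    rw [h.deriv, smul_smul]
    simp

namespace IsUnitaryGroup

variable {U : ℝ → H →L[ℂ] H} (hU : IsUnitaryGroup U)

include hU

lemma inner_map_map (s : ℝ) (x y : H) : ⟪U s x, U s y⟫_ℂ = ⟪x, y⟫_ℂ :=
  LinearIsometry.inner_map_map (⟨(U s : H →ₗ[ℂ] H), hU.norm_map s⟩ : H →ₗᵢ[ℂ] H) x y

lemma apply_add (s t : ℝ) (x : H) : U (s + t) x = U s (U t x) := by
  rw [hU.add]; rfl

lemma apply_zero (x : H) : U 0 x = x := by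
  rw [hU.zero]; rfl

lemma apply_neg_apply (s : ℝ) (x : H) : U s (U (-s) x) = x := by
  rw [← hU.apply_add, add_neg_cancel, hU.apply_zero]

lemma inner_map_left (s : ℝ) (x y : H) : ⟪U s x, y⟫_ℂ = ⟪x, U (-s) y⟫_ℂ := by
  rw [← hU.inner_map_map s x, hU.apply_neg_apply]

lemma hasDerivAt {x z : H} (h : (x, z) ∈ (generator U).graph) (s : ℝ) :
    HasDerivAt (fun s => U s x) (Complex.I • U s z) s := by
  have h0 := mem_generator_graph.mp h
  have h1 : HasDerivAt (fun r => U (r - s) x) (Complex.I • z) s := by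
    have := HasDerivAt.scomp (h := fun r : ℝ => r - s) (h' := (1 : ℝ)) s
      (by simpa using h0) ((hasDerivAt_id s).sub_const s)
    simpa [Function.comp_def] using this
  have h2 := ((U s).restrictScalars ℝ).hasFDerivAt.comp_hasDerivAt s h1
  have e : (fun r => U r x) = fun r => U s (U (r - s) x) := by
    funext r
    rw [← hU.apply_add, add_sub_cancel]
  rw [e]
  simpa [Function.comp_def] using h2

lemma mem_graph_map {x z : H} (h : (x, z) ∈ (generator U).graph) (s : ℝ) :
    (U s x, U s z) ∈ (generator U).graph := by
  rw [mem_generator_graph] at h ⊢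
  have h2 := ((U s).restrictScalars ℝ).hasFDerivAt.comp_hasDerivAt 0 h
  have e : (fun r => U r (U s x)) = fun r => U s (U r x) := by
    funext r
    rw [← hU.apply_add, ← hU.apply_add, add_comm]
  rw [e]
  simpa [Function.comp_def] using h2

/-- Symmetry of the generator, from differentiating the constant function `s ↦ ⟪U s y, U s x⟫` at
`0`. -/
lemma inner_graph {x z y w : H} (h : (x, z) ∈ (generator U).graph)
    (h' : (y, w) ∈ (generator U).graph) : ⟪w, x⟫_ℂ = ⟪y, z⟫_ℂ := by
  have h1 := (hU.hasDerivAt h' 0).inner ℂ (hU.hasDerivAt h 0)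
  simp only [hU.inner_map_map, hU.apply_zero] at h1
  have h2 := h1.unique (hasDerivAt_const (0 : ℝ) _)
  rw [inner_smul_left, inner_smul_right, Complex.conj_I] at h2
  have h3 : Complex.I * (⟪y, z⟫_ℂ - ⟪w, x⟫_ℂ) = 0 := by linear_combination h2
  have h4 := (mul_eq_zero.mp h3).resolve_left Complex.I_ne_zero
  exact (sub_eq_zero.mp h4).symm

/-- A formal adjoint of the restriction of a generator to a dense invariant subspace is a
restriction of the generator. -/
lemma mem_graph_of_formalAdjoint [CompleteSpace H] {D : Submodule ℂ H} (hd : Dense (D : Set H))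
    (hD : D ≤ (generator U).domain) (hinv : ∀ s, ∀ y ∈ D, U s y ∈ D) {x z : H}
    (h : ∀ y ∈ D, ∀ w, (y, w) ∈ (generator U).graph → ⟪w, x⟫_ℂ = ⟪y, z⟫_ℂ) :
    (x, z) ∈ (generator U).graph := by
  have hc : Continuous fun r => Complex.I • U r z := (hU.continuous z).const_smul _
  -- The orbit of `x` solves the integrated evolution equation. Tested against `y ∈ D`, `⟪y, U r x⟫
  -- = ⟪U (-r) y, x⟫`, which can be differentiated because `U (-r) y` stays in `D`, where `h`
  -- applies.
  have key : ∀ s : ℝ, U s x = x + ∫ r in (0 : ℝ)..s, Complex.I • U r z := by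
    intro s
    refine hd.eq_of_inner_right ℂ fun y hy => ?_
    obtain ⟨w, hw⟩ := LinearPMap.mem_domain_iff.mp (hD hy)
    have hder : ∀ r : ℝ, HasDerivAt (fun r => ⟪y, U r x⟫_ℂ) ⟪y, Complex.I • U r z⟫_ℂ r := by
      intro r
      have e : (fun r => ⟪y, U r x⟫_ℂ) = fun r => ⟪U (-r) y, x⟫_ℂ := by
        funext r
        rw [hU.inner_map_left, neg_neg]
      have h1 := HasDerivAt.scomp (h := fun r : ℝ => -r) (h' := (-1 : ℝ)) r
        (hU.hasDerivAt hw (-r)) (hasDerivAt_neg r)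
      have h2 := h1.inner ℂ (hasDerivAt_const r x)
      rw [e]
      have h3 := h _ (hinv (-r) y hy) _ (hU.mem_graph_map hw (-r))
      rw [hU.inner_map_left (-r) y z, neg_neg] at h3
      have h6 : ⟪U (-r) y, (0 : H)⟫_ℂ + ⟪(-1 : ℝ) • Complex.I • U (-r) w, x⟫_ℂ =
          ⟪y, Complex.I • U r z⟫_ℂ := by
        rw [neg_one_smul, inner_neg_left, inner_smul_left, inner_smul_right, h3, inner_zero_right,
          Complex.conj_I]
        ring
      rw [← h6]
      exact h2
    have h4 := intervalIntegral.integral_eq_sub_of_hasDerivAt (a := 0) (b := s)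
      (fun r _ => hder r)
      ((continuous_const.inner hc : Continuous fun r => ⟪y, Complex.I • U r z⟫_ℂ).intervalIntegrable
        _ _)
    have h5 : ⟪y, ∫ r in (0 : ℝ)..s, Complex.I • U r z⟫_ℂ =
        ∫ r in (0 : ℝ)..s, ⟪y, Complex.I • U r z⟫_ℂ :=
      ((innerSL ℂ y).intervalIntegral_comp_comm (hc.intervalIntegrable 0 s)).symm
    rw [inner_add_right, h5, h4, hU.apply_zero]
    ring
  rw [mem_generator_graph]
  have e : (fun s => U s x) = fun s => x + ∫ r in (0 : ℝ)..s, Complex.I • U r z := funext key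
  rw [e]
  have h6 := (hc.integral_hasStrictDerivAt 0 0).hasDerivAt.const_add x
  simpa [hU.apply_zero] using h6

end IsUnitaryGroup

/-- The double orthogonal complement is the closure. The product `H × H` carries the sup norm, so
the argument runs in `WithLp 2 (H × H)`, which has the same topology. -/
lemma mem_topologicalClosure_of_forall_inner [CompleteSpace H] {G : Submodule ℂ (H × H)} {x z : H}
    (h : ∀ p q : H, (∀ y w, (y, w) ∈ G → ⟪p, y⟫_ℂ + ⟪q, w⟫_ℂ = 0) → ⟪p, x⟫_ℂ + ⟪q, z⟫_ℂ = 0) :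
    (x, z) ∈ G.topologicalClosure := by
  let e := WithLp.prodContinuousLinearEquiv 2 ℂ H H
  let G' : Submodule ℂ (WithLp 2 (H × H)) := G.comap (e : WithLp 2 (H × H) →ₗ[ℂ] H × H)
  have h1 : e.symm (x, z) ∈ G'ᗮᗮ := by
    intro pq hpq
    have h2 := h pq.fst pq.snd fun y w hyw => by
      have h3 := hpq (e.symm (y, w)) (by simpa [G'] using hyw)
      have h4 := congrArg (starRingEnd ℂ) h3
      simpa [WithLp.prod_inner_apply, e] using h4
    simpa [WithLp.prod_inner_apply, e] using h2
  rw [Submodule.orthogonal_orthogonal_eq_closure] at h1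
  have h5 : Set.MapsTo e (G' : Set (WithLp 2 (H × H))) (G : Set (H × H)) := fun g hg => hg
  exact h5.closure e.continuous h1

/-- A partial operator which is defined on a dense invariant subspace of smooth vectors, and is
formally adjoint to the generator there, has the generator as its closure. -/
lemma closure_eq_generator [CompleteSpace H] {U : ℝ → H →L[ℂ] H} (hU : IsUnitaryGroup U)
    {D : Submodule ℂ H} (hd : Dense (D : Set H))
    (hD : D ≤ (generator U).domain) (hinv : ∀ s, ∀ y ∈ D, U s y ∈ D) {B : H →ₗ.[ℂ] H}
    (hDB : D ≤ B.domain)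
    (h : ∀ y ∈ D, ∀ w, (y, w) ∈ (generator U).graph → ∀ x : B.domain, ⟪w, x⟫_ℂ = ⟪y, B x⟫_ℂ) :
    B.closure = generator U := by
  have hle : B.graph ≤ (generator U).graph := by
    rintro ⟨x, z⟩ hx
    obtain ⟨x', rfl, rfl⟩ := (LinearPMap.mem_graph_iff _).mp hx
    exact hU.mem_graph_of_formalAdjoint hd hD hinv fun y hy w hw => h y hy w hw x'
  have hcl : (generator U).IsClosed := by
    -- The generator equals its formal adjoint over `D`, so its graph is an intersection of closed
    -- conditions.
    have e : ((generator U).graph : Set (H × H)) =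
        ⋂ (y : H) (w : H) (_ : y ∈ D) (_ : (y, w) ∈ (generator U).graph),
          {p : H × H | ⟪w, p.1⟫_ℂ = ⟪y, p.2⟫_ℂ} := by
      ext ⟨x, z⟩
      simp only [Set.mem_iInter, Set.mem_ofPred_eq, SetLike.mem_coe]
      exact ⟨fun hx y w _ hw => hU.inner_graph hx hw, fun hx =>
        hU.mem_graph_of_formalAdjoint hd hD hinv fun y hy w hw => hx y w hy hw⟩
    rw [LinearPMap.IsClosed, e]
    refine isClosed_iInter fun y => isClosed_iInter fun w => isClosed_iInter fun _ =>
      isClosed_iInter fun _ => isClosed_eq ?_ ?_ <;> fun_prop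
  have hB : B.IsClosable := hcl.isClosable.leIsClosable (LinearPMap.le_of_le_graph hle)
  apply LinearPMap.eq_of_eq_graph
  rw [← hB.graph_closure_eq_closure_graph]
  refine le_antisymm (Submodule.topologicalClosure_minimal _ hle hcl) ?_
  rintro ⟨x, z⟩ hx
  refine mem_topologicalClosure_of_forall_inner fun p q hpq => ?_
  -- A pair `(p, q)` orthogonal to the graph of `B` puts `(q, -p)` in the graph of the adjoint of
  -- `B` restricted to `D`, hence in that of the generator. Symmetry then makes `(p, q)` orthogonal
  -- to the whole graph of the generator.
  have hq : (q, -p) ∈ (generator U).graph := by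
    refine hU.mem_graph_of_formalAdjoint hd hD hinv fun y hy w hw => ?_
    have hyB : (y, w) ∈ B.graph := by
      have h1 : (y, B ⟨y, hDB hy⟩) ∈ B.graph := B.mem_graph ⟨y, hDB hy⟩
      rwa [(generator U).mem_graph_snd_inj hw (hle h1) rfl]
    have h2 := congrArg (starRingEnd ℂ) (hpq y w hyB)
    simp only [map_add, inner_conj_symm, map_zero] at h2
    rw [inner_neg_right]
    linear_combination h2
  have h3 := hU.inner_graph hx hq
  rw [inner_neg_left] at h3
  linear_combination -h3

/-- On the common domain `r ↦ ⟪U r x, V r x⟫` has zero derivative, so it stays `‖x‖²` and `‖U s x -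
V s x‖² = 0`. This makes the choice in `expI` immaterial. -/
lemma generator_injective {U V : ℝ → H →L[ℂ] H} (hU : IsUnitaryGroup U) (hV : IsUnitaryGroup V)
    (hd : Dense ((generator U).domain : Set H)) (h : generator U = generator V) : U = V := by
  funext s
  refine ContinuousLinearMap.coeFn_injective (Continuous.ext_on hd (U s).continuous
    (V s).continuous fun x hx => ?_)
  obtain ⟨z, hz⟩ := LinearPMap.mem_domain_iff.mp hx
  have hz' := hz
  rw [h] at hz'
  have hder : ∀ r : ℝ, HasDerivAt (fun r => ⟪U r x, V r x⟫_ℂ) 0 r := by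
    intro r
    have h1 := (hU.hasDerivAt hz r).inner ℂ (hV.hasDerivAt hz' r)
    have h2 := hU.mem_graph_map hz r
    have h3 := hV.mem_graph_map hz' r
    rw [← h] at h3
    have h4 : ⟪U r x, Complex.I • V r z⟫_ℂ + ⟪Complex.I • U r z, V r x⟫_ℂ = 0 := by
      rw [inner_smul_left, inner_smul_right, hU.inner_graph h3 h2, Complex.conj_I]
      ring
    rwa [h4] at h1
  have h4 := is_const_of_deriv_eq_zero (fun r => (hder r).differentiableAt)
    (fun r => (hder r).deriv) s 0
  simp only [hU.apply_zero, hV.apply_zero] at h4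
  have h5 : ‖U s x - V s x‖ ^ 2 = 0 := by
    rw [@norm_sub_sq ℂ, h4, hU.norm_map, hV.norm_map, inner_self_eq_norm_sq]
    ring
  simpa [sub_eq_zero] using h5

lemma expI_generator {U : ℝ → H →L[ℂ] H} (hU : IsUnitaryGroup U)
    (hd : Dense ((generator U).domain : Set H)) : expI (generator U) = U 1 := by
  have h : ∃ V : ℝ → H →L[ℂ] H, IsUnitaryGroup V ∧ generator V = generator U := ⟨U, hU, rfl⟩
  rw [expI, dif_pos h]
  exact congrFun (generator_injective hU h.choose_spec.1 hd h.choose_spec.2.symm).symm 1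

end UnitaryGroups

/-! ### Weak criteria for continuity and holomorphy -/

section WeakCriteria

variable {F : Type*} [NormedAddCommGroup F] [InnerProductSpace ℂ F]

/-- The quantity `‖f y - f x‖²` expands into four values of the kernel. This suits exponential and
creation vectors, which are known through their inner products. -/
lemma continuous_of_continuous_inner {X : Type*} [TopologicalSpace X] {f : X → F}
    (h : Continuous fun p : X × X => ⟪f p.1, f p.2⟫_ℂ) : Continuous f := by
  rw [continuous_iff_continuousAt]
  intro x
  rw [ContinuousAt, tendsto_iff_norm_sub_tendsto_zero]
  have h1 : Continuous fun y => √(RCLike.re (⟪f y, f y⟫_ℂ - ⟪f y, f x⟫_ℂ - ⟪f x, f y⟫_ℂ +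
      ⟪f x, f x⟫_ℂ)) := by
    refine Real.continuous_sqrt.comp (RCLike.continuous_re.comp ?_)
    have e : ∀ g k : X → X, Continuous g → Continuous k → Continuous fun y => ⟪f (g y), f (k y)⟫_ℂ :=
      fun g k hg hk => h.comp (hg.prodMk hk)
    exact (((e _ _ continuous_id continuous_id).sub (e _ _ continuous_id continuous_const)).sub
      (e _ _ continuous_const continuous_id)).add continuous_const
  have e : (fun y => ‖f y - f x‖) = fun y => √(RCLike.re (⟪f y, f y⟫_ℂ - ⟪f y, f x⟫_ℂ -
      ⟪f x, f y⟫_ℂ + ⟪f x, f x⟫_ℂ)) := by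
    funext y
    rw [← inner_sub_sub_self, ← @norm_eq_sqrt_re_inner ℂ]
  rw [e]
  have h2 := h1.tendsto x
  simpa using h2

/-- For continuous `f` the Cauchy integral over a unit circle exists and is holomorphic inside. The
scalar Cauchy formula, tested on the dense span of `S`, shows that it coincides with `f`. -/
lemma differentiable_of_differentiable_inner [CompleteSpace F] {f : ℂ → F} (hf : Continuous f)
    {S : Set F} (hS : Dense (Submodule.span ℂ S : Set F))
    (h : ∀ w ∈ S, Differentiable ℂ fun z => ⟪w, f z⟫_ℂ) : Differentiable ℂ f := by
  intro z₀
  have hci : CircleIntegrable f z₀ (1 : NNReal) := hf.continuousOn.circleIntegrable (by simp)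
  have h1 := (hasFPowerSeriesOn_cauchy_integral hci one_pos).differentiableOn
  have hz : z₀ ∈ Metric.eball z₀ ((1 : NNReal) : ENNReal) := by simp
  refine ((h1.differentiableAt (Metric.isOpen_eball.mem_nhds hz))).congr_of_eventuallyEq ?_
  filter_upwards [Metric.isOpen_eball.mem_nhds hz] with z hz'
  have hz1 : z ∈ Metric.ball z₀ ((1 : NNReal) : ℝ) := by
    rwa [← Metric.eball_coe]
  have hne : ∀ θ, circleMap z₀ ((1 : NNReal) : ℝ) θ - z ≠ 0 := by
    intro θ h0
    have h2 := circleMap_ne_mem_ball hz1 θ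
    exact h2 (sub_eq_zero.mp h0)
  have hint : IntervalIntegrable (fun θ => deriv (circleMap z₀ ((1 : NNReal) : ℝ)) θ •
      ((circleMap z₀ ((1 : NNReal) : ℝ) θ - z)⁻¹ • f (circleMap z₀ ((1 : NNReal) : ℝ) θ)))
      volume 0 (2 * Real.pi) := by
    apply Continuous.intervalIntegrable
    simp only [deriv_circleMap]
    have hcm := continuous_circleMap z₀ ((1 : NNReal) : ℝ)
    exact ((continuous_circleMap 0 _).mul continuous_const).smul
      (((hcm.sub continuous_const).inv₀ hne).smul (hf.comp hcm))
  refine hS.eq_of_inner_right ℂ fun w hw => ?_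
  have key : Differentiable ℂ fun z => ⟪w, f z⟫_ℂ := by
    refine Submodule.span_induction (p := fun w _ => Differentiable ℂ fun z => ⟪w, f z⟫_ℂ) h ?_ ?_
      ?_ hw
    · simp
    · intro x y _ _ hx hy
      simpa only [inner_add_left] using hx.fun_add hy
    · intro a x _ hx
      simpa only [inner_smul_left] using hx.const_mul _
  have h3 := key.diffContOnCl (s := Metric.ball z₀ ((1 : NNReal) : ℝ))
  rw [← h3.two_pi_i_inv_smul_circleIntegral_sub_inv_smul hz1, inner_smul_right, smul_eq_mul]
  congr 1
  have h4 := (innerSL ℂ w).intervalIntegral_comp_comm hint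
  refine Eq.trans ?_ h4
  refine intervalIntegral.integral_congr fun θ _ => ?_
  simp

end WeakCriteria

/-! ### Exponential and creation vectors -/

section Exponential

variable {K : Type} [NormedAddCommGroup K] [InnerProductSpace ℂ K]

variable (K) in
/-- The linear span of the exponential vectors. -/
def expSpan : Submodule ℂ (Fock K) := Submodule.span ℂ (Set.range expVec)

lemma expVec_mem_expSpan (v : K) : expVec v ∈ expSpan K := Submodule.subset_span ⟨v, rfl⟩

lemma dense_expSpan : Dense (expSpan K : Set (Fock K)) := by
  have h := denseRange_expVec (K := K)
  rw [DenseRange, ← LinearMap.coe_range, Finsupp.range_linearCombination] at h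
  exact h

lemma fock_ext {x y : Fock K} (h : ∀ w : K, ⟪expVec w, x⟫_ℂ = ⟪expVec w, y⟫_ℂ) : x = y := by
  refine dense_expSpan.eq_of_inner_right ℂ fun w hw => ?_
  refine Submodule.span_induction (p := fun w _ => ⟪w, x⟫_ℂ = ⟪w, y⟫_ℂ) ?_ ?_ ?_ ?_ hw
  · rintro _ ⟨w, rfl⟩
    exact h w
  · simp
  · intro a b _ _ ha hb
    rw [inner_add_left, inner_add_left, ha, hb]
  · intro c a _ ha
    rw [inner_smul_left, inner_smul_left, ha]

lemma fock_clm_ext {E : Type*} [NormedAddCommGroup E] [NormedSpace ℂ E] {f g : Fock K →L[ℂ] E}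
    (h : ∀ v, f (expVec v) = g (expVec v)) : f = g := by
  refine ContinuousLinearMap.ext_on dense_expSpan ?_
  rintro _ ⟨v, rfl⟩
  exact h v

lemma weyl_zero : weyl (0 : K) = 1 := by
  refine fock_clm_ext fun v => ?_
  simp [weyl_expVec]

lemma weyl_weyl (u v : K) (x : Fock K) : weyl u (weyl v x) =
    Complex.exp (-Complex.I * ((⟪u, v⟫_ℂ).im : ℂ)) • weyl (u + v) x := by
  have h : (weyl u).comp (weyl v) =
      Complex.exp (-Complex.I * ((⟪u, v⟫_ℂ).im : ℂ)) • weyl (u + v) := by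
    refine fock_clm_ext fun w => ?_
    simp only [ContinuousLinearMap.comp_apply, weyl_expVec, map_smul, smul_smul,
      smul_apply, ← Complex.exp_add, ← add_assoc]
    congr 2
    have h1 := @norm_add_sq ℂ _ _ _ _ u v
    have h2 := Complex.re_add_im ⟪u, v⟫_ℂ
    rw [h1, inner_add_right, inner_add_left]
    push_cast
    simp only [RCLike.re_eq_complex_re]
    linear_combination h2
  exact congrArg (fun f => f x) h

lemma norm_weyl (u : K) (x : Fock K) : ‖weyl u x‖ = ‖x‖ := by
  refine (denseRange_expVec (K := K)).induction_on (p := fun x => ‖weyl u x‖ = ‖x‖) x ?_ ?_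
  · exact isClosed_eq (by fun_prop) (by fun_prop)
  · intro f
    rw [← norm_linearCombination_weylVec u]
    congr 1
    simp only [Finsupp.linearCombination_apply, Finsupp.sum, map_sum, map_smul, weyl_expVec, weylVec]

lemma continuous_expVec : Continuous (expVec : K → Fock K) := by
  refine continuous_of_continuous_inner ?_
  simp only [inner_expVec]
  fun_prop

lemma differentiable_expVec_line (v g : K) : Differentiable ℂ fun z : ℂ => expVec (v + z • g) := by
  refine differentiable_of_differentiable_inner (continuous_expVec.comp (by fun_prop))
    (S := Set.range expVec) dense_expSpan ?_
  rintro _ ⟨w, rfl⟩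
  simp only [inner_expVec, inner_add_right, inner_smul_right]
  fun_prop

/-- The vector `a(g)* expVec v`. -/
def creationVec (g v : K) : Fock K := deriv (fun z : ℂ => expVec (v + z • g)) 0

lemma hasDerivAt_expVec_line (v g : K) (z : ℂ) :
    HasDerivAt (fun z : ℂ => expVec (v + z • g)) (creationVec g (v + z • g)) z := by
  have h : HasDerivAt (fun y : ℂ => expVec (v + z • g + y • g)) (creationVec g (v + z • g)) (z - z) :=
    (sub_self z).symm ▸ (differentiable_expVec_line (v + z • g) g 0).hasDerivAt
  have h1 := h.comp_sub_const
  have e : (fun y : ℂ => expVec (v + y • g)) = fun y : ℂ => expVec (v + z • g + (y - z) • g) := by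
    funext r
    rw [add_assoc, ← add_smul, add_sub_cancel]
  rw [e]
  exact h1

lemma hasDerivAt_expVec_line_zero (v g : K) :
    HasDerivAt (fun z : ℂ => expVec (v + z • g)) (creationVec g v) 0 := by
  simpa using hasDerivAt_expVec_line v g 0

lemma inner_creationVec_right (w g v : K) :
    ⟪expVec w, creationVec g v⟫_ℂ = ⟪w, g⟫_ℂ * Complex.exp ⟪w, v⟫_ℂ := by
  have h1 := (innerSL ℂ (expVec w)).hasFDerivAt.comp_hasDerivAt 0 (hasDerivAt_expVec_line_zero v g)
  have h2 : HasDerivAt (fun z : ℂ => Complex.exp (⟪w, v⟫_ℂ + z * ⟪w, g⟫_ℂ))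
      (Complex.exp (⟪w, v⟫_ℂ + 0 * ⟪w, g⟫_ℂ) * (1 * ⟪w, g⟫_ℂ)) 0 :=
    (((hasDerivAt_id (0 : ℂ)).mul_const _).const_add _).cexp
  have e : (fun z : ℂ => Complex.exp (⟪w, v⟫_ℂ + z * ⟪w, g⟫_ℂ)) =
      innerSL ℂ (expVec w) ∘ fun z : ℂ => expVec (v + z • g) := by
    funext z
    rw [Function.comp_apply, innerSL_apply_apply, inner_expVec, inner_add_right, inner_smul_right]
  rw [e] at h2
  have h3 := h1.unique h2
  simp only [innerSL_apply_apply] at h3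
  rw [h3]
  simp [mul_comm]

lemma inner_creationVec_creationVec (g v h w : K) :
    ⟪creationVec g v, creationVec h w⟫_ℂ =
      (⟪g, h⟫_ℂ + ⟪g, w⟫_ℂ * ⟪v, h⟫_ℂ) * Complex.exp ⟪v, w⟫_ℂ := by
  have h1 := (innerSL ℂ (creationVec g v)).hasFDerivAt.comp_hasDerivAt 0
    (hasDerivAt_expVec_line_zero w h)
  have h2 : HasDerivAt (fun z : ℂ => (⟪g, w⟫_ℂ + z * ⟪g, h⟫_ℂ) *
      Complex.exp (⟪v, w⟫_ℂ + z * ⟪v, h⟫_ℂ)) ((1 * ⟪g, h⟫_ℂ) *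
      Complex.exp (⟪v, w⟫_ℂ + 0 * ⟪v, h⟫_ℂ) + (⟪g, w⟫_ℂ + 0 * ⟪g, h⟫_ℂ) *
      (Complex.exp (⟪v, w⟫_ℂ + 0 * ⟪v, h⟫_ℂ) * (1 * ⟪v, h⟫_ℂ))) 0 :=
    (((hasDerivAt_id (0 : ℂ)).mul_const _).const_add _).mul
      (((hasDerivAt_id (0 : ℂ)).mul_const _).const_add _).cexp
  have e : (fun z : ℂ => (⟪g, w⟫_ℂ + z * ⟪g, h⟫_ℂ) * Complex.exp (⟪v, w⟫_ℂ + z * ⟪v, h⟫_ℂ)) =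
      innerSL ℂ (creationVec g v) ∘ fun z : ℂ => expVec (w + z • h) := by
    funext z
    rw [Function.comp_apply, innerSL_apply_apply, ← inner_conj_symm (creationVec g v),
      inner_creationVec_right, map_mul, inner_conj_symm, ← Complex.exp_conj, inner_conj_symm]
    simp only [inner_add_right, inner_smul_right]
  rw [e] at h2
  have h3 := h1.unique h2
  simp only [innerSL_apply_apply] at h3
  rw [h3]
  ring_nf

lemma continuous_creationVec : Continuous fun p : K × K => creationVec p.1 p.2 := by
  refine continuous_of_continuous_inner ?_
  simp only [inner_creationVec_creationVec]
  fun_prop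

lemma differentiable_creationVec_line (g v h : K) :
    Differentiable ℂ fun z : ℂ => creationVec g (v + z • h) := by
  refine differentiable_of_differentiable_inner
    (Continuous.comp (g := fun p : K × K => creationVec p.1 p.2) (f := fun z : ℂ => (g, v + z • h))
      continuous_creationVec (by fun_prop))
    (S := Set.range expVec) dense_expSpan ?_
  rintro _ ⟨w, rfl⟩
  simp only [inner_creationVec_right, inner_add_right, inner_smul_right]
  fun_prop

/-- Differentiate the action on `expVec (v + z • g)` at `z = 0`; the scalar prefactor contributes
the term with `⟪u, g⟫`. -/
lemma weyl_creationVec (u g v : K) : weyl u (creationVec g v) =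
    Complex.exp (-(‖u‖ ^ 2 : ℝ) / 2 - ⟪u, v⟫_ℂ) •
      (creationVec g (u + v) - ⟪u, g⟫_ℂ • expVec (u + v)) := by
  have h1 := (weyl u).hasFDerivAt.comp_hasDerivAt 0 (hasDerivAt_expVec_line_zero v g)
  have h2 : HasDerivAt (fun z : ℂ => Complex.exp (-(‖u‖ ^ 2 : ℝ) / 2 - (⟪u, v⟫_ℂ + z * ⟪u, g⟫_ℂ)))
      (Complex.exp (-(‖u‖ ^ 2 : ℝ) / 2 - (⟪u, v⟫_ℂ + 0 * ⟪u, g⟫_ℂ)) * (-(1 * ⟪u, g⟫_ℂ))) 0 :=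
    ((((hasDerivAt_id (0 : ℂ)).mul_const _).const_add _).const_sub _).cexp
  have h3 := h2.smul (hasDerivAt_expVec_line_zero (u + v) g)
  have e : (weyl u ∘ fun z : ℂ => expVec (v + z • g)) = (fun z : ℂ =>
      Complex.exp (-(‖u‖ ^ 2 : ℝ) / 2 - (⟪u, v⟫_ℂ + z * ⟪u, g⟫_ℂ))) •
        fun z : ℂ => expVec (u + v + z • g) := by
    funext z
    rw [Function.comp_apply, weyl_expVec, inner_add_right, inner_smul_right, ← add_assoc]
    rfl
  rw [e] at h1
  rw [h1.unique h3]
  simp only [zero_mul, add_zero, zero_smul, one_mul, smul_sub, smul_smul]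
  rw [mul_neg, neg_smul, ← sub_eq_add_neg]

end Exponential

/-! ### Field operators -/

section FieldOperators

variable {K : Type} [NormedAddCommGroup K] [InnerProductSpace ℂ K]

/-- Orbits of the Weyl groups are restrictions to the imaginary axis of entire functions; this
converts the complex derivative into the one in the definition of `generator`. -/
lemma hasDerivAt_imaginary_line {F : Type*} [NormedAddCommGroup F] [NormedSpace ℂ F] {f : ℂ → F}
    {f' : F} (hf : HasDerivAt f f' 0) :
    HasDerivAt (fun s : ℝ => f ((s : ℂ) * Complex.I)) (Complex.I • f') 0 := by
  have h1 : HasDerivAt (fun s : ℝ => (s : ℂ) * Complex.I) (1 * Complex.I) 0 :=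
    (Complex.ofRealCLM.hasDerivAt (x := (0 : ℝ))).mul_const _
  have h2 := HasDerivAt.scomp_of_eq (0 : ℝ) hf h1 (by simp)
  rw [one_mul] at h2
  exact h2

lemma norm_imaginary_smul_sq (s : ℝ) (h : K) :
    ‖((s : ℂ) * Complex.I) • h‖ ^ 2 = s ^ 2 * ‖h‖ ^ 2 := by
  rw [norm_smul, mul_pow]
  simp

lemma inner_imaginary_smul_left (s : ℝ) (h v : K) :
    ⟪((s : ℂ) * Complex.I) • h, v⟫_ℂ = -((s : ℂ) * Complex.I) * ⟪h, v⟫_ℂ := by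
  rw [inner_smul_left]
  simp

lemma isUnitaryGroup_weyl (h : K) : IsUnitaryGroup fun s : ℝ => weyl (((s : ℂ) * Complex.I) • h) where
  zero := by simp [weyl_zero]
  add s t := by
    refine ContinuousLinearMap.ext fun x => ?_
    -- The inner product is `s t ‖h‖²`, which is real, so the Weyl phase is trivial along one
    -- direction.
    have him : (⟪((s : ℂ) * Complex.I) • h, ((t : ℂ) * Complex.I) • h⟫_ℂ).im = 0 := by
      rw [inner_imaginary_smul_left, inner_smul_right, inner_self_eq_norm_sq_to_K]
      have e : -((s : ℂ) * Complex.I) * ((t : ℂ) * Complex.I * ((‖h‖ : ℂ) ^ 2)) =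
          ((s * t * ‖h‖ ^ 2 : ℝ) : ℂ) := by
        push_cast
        linear_combination (-(s : ℂ) * t * (‖h‖ : ℂ) ^ 2) * Complex.I_mul_I
      exact (congrArg Complex.im e).trans (Complex.ofReal_im _)
    rw [mul_apply_eq_comp, weyl_weyl, him, ← add_smul, ← add_mul]
    simp
  norm_map s x := norm_weyl _ x
  continuous x := by
    have hexp : ∀ v : K, Continuous fun s : ℝ => weyl (((s : ℂ) * Complex.I) • h) (expVec v) := by
      intro v
      simp only [weyl_expVec]
      exact (by fun_prop : Continuous fun s : ℝ => Complex.exp (-(‖((s : ℂ) * Complex.I) • h‖ ^ 2 : ℝ) / 2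
        - ⟪((s : ℂ) * Complex.I) • h, v⟫_ℂ)).smul (continuous_expVec.comp (by fun_prop))
    have hspan : ∀ y ∈ expSpan K, Continuous fun s : ℝ => weyl (((s : ℂ) * Complex.I) • h) y := by
      intro y hy
      refine Submodule.span_induction
        (p := fun y _ => Continuous fun s : ℝ => weyl (((s : ℂ) * Complex.I) • h) y) ?_ ?_ ?_ ?_ hy
      · rintro _ ⟨v, rfl⟩
        exact hexp v
      · simpa using continuous_const
      · intro a b _ _ ha hb
        simp only [map_add]
        exact ha.add hb
      · intro c a _ ha
        simp only [map_smul]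
        exact ha.const_smul c
    -- The operators are isometric, so approximating `x` by a vector of the span approximates its
    -- orbit uniformly in `s`.
    refine continuous_of_uniform_approx_of_continuous fun u hu => ?_
    obtain ⟨ε, hε, hu⟩ := Metric.mem_uniformity_dist.mp hu
    obtain ⟨y, hy, hxy⟩ := dense_expSpan.exists_dist_lt x hε
    refine ⟨_, hspan y hy, fun s => hu ?_⟩
    rwa [dist_eq_norm, ← map_sub, norm_weyl, ← dist_eq_norm]

/-- The vector `(a(h) + a(h)*) expVec v`. -/
def fieldVec (h v : K) : Fock K := ⟪h, v⟫_ℂ • expVec v + creationVec h v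

lemma inner_fieldVec (w h v : K) :
    ⟪expVec w, fieldVec h v⟫_ℂ = (⟪h, v⟫_ℂ + ⟪w, h⟫_ℂ) * Complex.exp ⟪w, v⟫_ℂ := by
  rw [fieldVec, inner_add_right, inner_smul_right, inner_expVec, inner_creationVec_right]
  ring

/-- The action of the field operators on an exponential vector is real linear and continuous. -/
def fieldVecCLM (v : K) : K →L[ℝ] Fock K where
  toFun h := fieldVec h v
  map_add' g h := fock_ext fun w => by
    simp only [inner_add_right, inner_fieldVec, inner_add_left]
    ring
  map_smul' c h := fock_ext fun w => by
    rw [RingHom.id_apply, inner_fieldVec, ← Complex.coe_smul, ← Complex.coe_smul, inner_smul_right,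
      inner_smul_right, inner_smul_left, inner_fieldVec, Complex.conj_ofReal]
    ring
  cont := by
    have h1 : Continuous fun h : K => creationVec h v :=
      Continuous.comp (g := fun p : K × K => creationVec p.1 p.2) (f := fun h : K => (h, v))
        continuous_creationVec (by fun_prop)
    have h2 : Continuous fun h : K => ⟪h, v⟫_ℂ • expVec v :=
      (by fun_prop : Continuous fun h : K => ⟪h, v⟫_ℂ).smul continuous_const
    exact h2.add h1

lemma fieldVecCLM_apply (h v : K) : fieldVecCLM v h = fieldVec h v := rfl

/-- At `z = i s` one has `-‖z h‖² = z² ‖h‖²` and `-⟪z h, v⟫ = z ⟪h, v⟫`. So the orbit is the value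
at `i s` of the entire function `exp (z² ‖h‖² / 2 + z ⟪h, v⟫) expVec (v + z h)`. -/
lemma expVec_mem_fieldOp_graph (h v : K) : (expVec v, fieldVec h v) ∈ (fieldOp h).graph := by
  rw [fieldOp, mem_generator_graph]
  have h1 : HasDerivAt (fun s : ℝ => (s : ℂ) * Complex.I) (1 * Complex.I) 0 :=
    (Complex.ofRealCLM.hasDerivAt (x := (0 : ℝ))).mul_const _
  have h2 : HasDerivAt (fun z : ℂ => Complex.exp (z ^ 2 * (‖h‖ : ℂ) ^ 2 / 2 + z * ⟪h, v⟫_ℂ))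
      (Complex.exp ((0 : ℂ) ^ 2 * (‖h‖ : ℂ) ^ 2 / 2 + 0 * ⟪h, v⟫_ℂ) *
        (((2 : ℕ) * (0 : ℂ) ^ (2 - 1) * 1) * (‖h‖ : ℂ) ^ 2 / 2 + 1 * ⟪h, v⟫_ℂ)) 0 :=
    (((((hasDerivAt_id (0 : ℂ)).pow 2).mul_const _).div_const _).add
      ((hasDerivAt_id (0 : ℂ)).mul_const _)).cexp
  have h3 := hasDerivAt_imaginary_line (h2.smul (hasDerivAt_expVec_line_zero v h))
  have e : (fun s : ℝ => weyl (((s : ℂ) * Complex.I) • h) (expVec v)) = fun s : ℝ =>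
      ((fun z : ℂ => Complex.exp (z ^ 2 * (‖h‖ : ℂ) ^ 2 / 2 + z * ⟪h, v⟫_ℂ)) •
        fun z : ℂ => expVec (v + z • h)) ((s : ℂ) * Complex.I) := by
    funext s
    rw [Pi.smul_apply', weyl_expVec, norm_imaginary_smul_sq, inner_imaginary_smul_left, add_comm v]
    congr 2
    push_cast
    linear_combination (-(s : ℂ) ^ 2 * (‖h‖ : ℂ) ^ 2 / 2) * Complex.I_sq
  rw [e]
  have e2 : fieldVec h v = Complex.exp ((0 : ℂ) ^ 2 * (‖h‖ : ℂ) ^ 2 / 2 + 0 * ⟪h, v⟫_ℂ) • creationVec h v +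
      (Complex.exp ((0 : ℂ) ^ 2 * (‖h‖ : ℂ) ^ 2 / 2 + 0 * ⟪h, v⟫_ℂ) *
        (((2 : ℕ) * (0 : ℂ) ^ (2 - 1) * 1) * (‖h‖ : ℂ) ^ 2 / 2 + 1 * ⟪h, v⟫_ℂ)) •
          expVec (v + (0 : ℂ) • h) := by
    rw [fieldVec, add_comm]
    simp
  rw [e2]
  exact h3

/-- A field operator maps the vacuum to a creation vector; products of two field operators need that
vector in the domain of the second one. Again the orbit extends to an entire function. -/
lemma creationVec_zero_mem_fieldOp_domain (g h : K) : creationVec g 0 ∈ (fieldOp h).domain := by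
  have h2 : Differentiable ℂ fun z : ℂ => Complex.exp (z ^ 2 * (‖h‖ : ℂ) ^ 2 / 2) •
      (creationVec g (0 + z • h) + (z * ⟪h, g⟫_ℂ) • expVec (0 + z • h)) := by
    have h3 : Differentiable ℂ fun z : ℂ => Complex.exp (z ^ 2 * (‖h‖ : ℂ) ^ 2 / 2) := by fun_prop
    have h4 : Differentiable ℂ fun z : ℂ => z * ⟪h, g⟫_ℂ := by fun_prop
    exact h3.smul ((differentiable_creationVec_line g 0 h).add
      (h4.smul (differentiable_expVec_line 0 h)))
  have h3 := hasDerivAt_imaginary_line (h2 0).hasDerivAt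
  have e : (fun s : ℝ => weyl (((s : ℂ) * Complex.I) • h) (creationVec g 0)) = fun s : ℝ =>
      Complex.exp (((s : ℂ) * Complex.I) ^ 2 * (‖h‖ : ℂ) ^ 2 / 2) •
      (creationVec g (0 + ((s : ℂ) * Complex.I) • h) + ((s : ℂ) * Complex.I * ⟪h, g⟫_ℂ) •
        expVec (0 + ((s : ℂ) * Complex.I) • h)) := by
    funext s
    rw [weyl_creationVec, norm_imaginary_smul_sq, inner_imaginary_smul_left,
      inner_imaginary_smul_left, inner_zero_right, add_comm _ (0 : K), neg_mul, neg_mul, neg_smul,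
      sub_neg_eq_add]
    congr 2
    · push_cast
      linear_combination (-(s : ℂ) ^ 2 * (‖h‖ : ℂ) ^ 2 / 2) * Complex.I_sq
    · exact sub_neg_eq_add _ _
  rw [← e] at h3
  exact h3.differentiableAt

lemma expSpan_le_fieldOp_domain (h : K) : expSpan K ≤ (fieldOp h).domain := by
  refine Submodule.span_le.mpr ?_
  rintro _ ⟨v, rfl⟩
  exact LinearPMap.mem_domain_of_mem_graph (expVec_mem_fieldOp_graph h v)

lemma dense_fieldOp_domain (h : K) : Dense ((fieldOp h).domain : Set (Fock K)) :=
  dense_expSpan.mono (expSpan_le_fieldOp_domain h)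

lemma weyl_mem_expSpan (u : K) {y : Fock K} (hy : y ∈ expSpan K) : weyl u y ∈ expSpan K := by
  have h : expSpan K ≤ (expSpan K).comap (weyl u : Fock K →ₗ[ℂ] Fock K) := by
    refine Submodule.span_le.mpr ?_
    rintro _ ⟨v, rfl⟩
    simp only [Submodule.comap_coe, Set.mem_preimage, SetLike.mem_coe, ContinuousLinearMap.coe_coe,
      weyl_expVec]
    exact Submodule.smul_mem _ _ (expVec_mem_expSpan _)
  exact h hy

lemma expI_fieldOp (h : K) : expI (fieldOp h) = weyl (Complex.I • h) := by
  rw [fieldOp, expI_generator (isUnitaryGroup_weyl h) (dense_fieldOp_domain h)]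
  simp

/-- The operator `B` is defined on the exponential vectors and is formally adjoint there to the
field operator of `h`. -/
structure IsFieldOnExp (B : Fock K →ₗ.[ℂ] Fock K) (h : K) : Prop where
  mem_domain : ∀ v, expVec v ∈ B.domain
  inner_eq : ∀ v, ∀ x : B.domain, ⟪fieldVec h v, (x : Fock K)⟫_ℂ = ⟪expVec v, B x⟫_ℂ

namespace IsFieldOnExp

variable {B C : Fock K →ₗ.[ℂ] Fock K} {g h : K}

/-- All later identifications of sums, multiples and integrals with field operators go through this:
adjointness on exponential vectors extends linearly to their span, which is a core. -/
lemma closure_eq (hB : IsFieldOnExp B h) : B.closure = fieldOp h := by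
  refine closure_eq_generator (isUnitaryGroup_weyl h) dense_expSpan (expSpan_le_fieldOp_domain h)
    (fun s y hy => weyl_mem_expSpan _ hy) ?_ ?_
  · refine Submodule.span_le.mpr ?_
    rintro _ ⟨v, rfl⟩
    exact hB.mem_domain v
  · intro y hy
    refine Submodule.span_induction (p := fun y _ => ∀ w, (y, w) ∈ (fieldOp h).graph →
      ∀ x : B.domain, ⟪w, (x : Fock K)⟫_ℂ = ⟪y, B x⟫_ℂ) ?_ ?_ ?_ ?_ hy
    · rintro _ ⟨v, rfl⟩ w hw x
      rw [(fieldOp h).mem_graph_snd_inj hw (expVec_mem_fieldOp_graph h v) rfl]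
      exact hB.inner_eq v x
    · intro w hw x
      rw [(fieldOp h).graph_fst_eq_zero_snd hw rfl, inner_zero_left, inner_zero_left]
    · intro a b ha hb iha ihb w hw x
      obtain ⟨wa, hwa⟩ := LinearPMap.mem_domain_iff.mp (expSpan_le_fieldOp_domain h ha)
      obtain ⟨wb, hwb⟩ := LinearPMap.mem_domain_iff.mp (expSpan_le_fieldOp_domain h hb)
      rw [(fieldOp h).mem_graph_snd_inj hw (Submodule.add_mem _ hwa hwb) rfl]
      change ⟪wa + wb, (x : Fock K)⟫_ℂ = _
      rw [inner_add_left, inner_add_left, iha _ hwa, ihb _ hwb]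
    · intro c a ha iha w hw x
      obtain ⟨wa, hwa⟩ := LinearPMap.mem_domain_iff.mp (expSpan_le_fieldOp_domain h ha)
      rw [(fieldOp h).mem_graph_snd_inj hw (Submodule.smul_mem _ c hwa) rfl]
      change ⟪c • wa, (x : Fock K)⟫_ℂ = _
      rw [inner_smul_left, inner_smul_left, iha _ hwa]

lemma zero : IsFieldOnExp (0 : Fock K →ₗ.[ℂ] Fock K) 0 where
  mem_domain v := Submodule.mem_top
  inner_eq v x := by
    rw [← fieldVecCLM_apply, map_zero, inner_zero_left]
    exact (inner_zero_right _).symm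

lemma add (hB : IsFieldOnExp B g) (hC : IsFieldOnExp C h) : IsFieldOnExp (B + C) (g + h) where
  mem_domain v := ⟨hB.mem_domain v, hC.mem_domain v⟩
  inner_eq v x := by
    have h1 : (B + C) x = B ⟨x, x.2.1⟩ + C ⟨x, x.2.2⟩ := rfl
    rw [h1, inner_add_right, ← hB.inner_eq, ← hC.inner_eq, ← fieldVecCLM_apply, map_add,
      inner_add_left]
    rfl

lemma smul (hB : IsFieldOnExp B g) (c : ℝ) : IsFieldOnExp ((c : ℂ) • B) ((c : ℂ) • g) where
  mem_domain v := hB.mem_domain v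
  inner_eq v x := by
    rw [LinearPMap.smul_apply, inner_smul_right, ← hB.inner_eq, Complex.coe_smul,
      ← fieldVecCLM_apply, map_smul, ← Complex.coe_smul, inner_smul_left, Complex.conj_ofReal]
    rfl

lemma sum {ι : Type*} {B : ι → Fock K →ₗ.[ℂ] Fock K} {g : ι → K} (s : Finset ι)
    (h : ∀ i ∈ s, IsFieldOnExp (B i) (g i)) : IsFieldOnExp (∑ i ∈ s, B i) (∑ i ∈ s, g i) := by
  classical
  induction s using Finset.induction_on with
  | empty => exact zero
  | insert i s hi ih =>
    rw [Finset.sum_insert hi, Finset.sum_insert hi]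
    exact (h i (Finset.mem_insert_self i s)).add
      (ih fun j hj => h j (Finset.mem_insert_of_mem hj))

end IsFieldOnExp

lemma isFieldOnExp_fieldOp (h : K) : IsFieldOnExp (fieldOp h) h where
  mem_domain v := expSpan_le_fieldOp_domain h (expVec_mem_expSpan v)
  inner_eq v x := (isUnitaryGroup_weyl h).inner_graph ((fieldOp h).mem_graph x)
    (expVec_mem_fieldOp_graph h v)

lemma linComb_fieldOp {ι : Type} [Fintype ι] (u : ι → ℝ) (g : ι → K) :
    linComb u (fun a => fieldOp (g a)) = fieldOp (∑ a, (u a : ℂ) • g a) :=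
  (IsFieldOnExp.sum _ fun a _ => (isFieldOnExp_fieldOp (g a)).smul (u a)).closure_eq

/-- No closure is taken here, so the domains must agree exactly: one inclusion holds for every `c`,
and the other is the same inclusion for `c⁻¹` at `c • h`. -/
lemma smul_fieldOp {c : ℝ} (hc : c ≠ 0) (h : K) : (c : ℂ) • fieldOp h = fieldOp ((c : ℂ) • h) := by
  have hle : ∀ (c : ℝ) (h : K), (c : ℂ) • fieldOp h ≤ fieldOp ((c : ℂ) • h) := by
    intro c h
    have h1 := ((isFieldOnExp_fieldOp h).smul c).closure_eq
    rw [← h1]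
    exact LinearPMap.le_closure _
  refine le_antisymm (hle c h) ?_
  refine ⟨fun x hx => ?_, fun x y hxy => ((hle c h).2 hxy.symm).symm⟩
  have h1 := (hle c⁻¹ ((c : ℂ) • h)).1
  rw [smul_smul, ← Complex.ofReal_mul, inv_mul_cancel₀ hc, Complex.ofReal_one, one_smul] at h1
  exact h1 hx

/-- On an exponential vector the field operator is real linear and continuous in its test vector
(`fieldVecCLM`), so the integral over `t` moves onto the test vector. Symmetry of each `A t` handles
the other vectors of the initial domain. -/
lemma strongIntegral_fieldOp [CompleteSpace K] {T : ℝ} {φ : ℝ → ℝ} (hφ : Continuous φ)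
    {h : ℝ → K} (hh : ContinuousOn h (Set.Icc 0 T)) {A : ℝ → Fock K →ₗ.[ℂ] Fock K}
    (hA : ∀ t ∈ Set.Icc 0 T, A t = fieldOp (h t)) {g : K}
    (hg : ∀ w, ⟪w, g⟫_ℂ = ∫ t in Set.Icc 0 T, (φ t : ℂ) * ⟪w, h t⟫_ℂ) :
    strongIntegral T φ A = fieldOp g := by
  have hint : IntegrableOn (fun t => (φ t : ℂ) • h t) (Set.Icc 0 T) :=
    ((Complex.continuous_ofReal.comp hφ).continuousOn.smul hh).integrableOn_compact isCompact_Icc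
  have hg' : g = ∫ t in Set.Icc 0 T, (φ t : ℂ) • h t := by
    refine ext_inner_left ℂ fun w => ?_
    rw [hg, ← integral_inner hint]
    simp only [inner_smul_right]
  rw [hg']
  have hexp : ∀ v, ∀ t ∈ Set.Icc 0 T, φ t • applyOrZero (A t) (expVec v) =
      fieldVecCLM v ((φ t : ℂ) • h t) := by
    intro v t ht
    have hm : expVec v ∈ (fieldOp (h t)).domain := (isFieldOnExp_fieldOp _).mem_domain v
    rw [hA t ht, applyOrZero, dif_pos hm, Complex.coe_smul, map_smul, fieldVecCLM_apply,
      (fieldOp (h t)).mem_graph_snd_inj ((fieldOp (h t)).mem_graph ⟨_, hm⟩)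
        (expVec_mem_fieldOp_graph (h t) v) rfl]
  refine IsFieldOnExp.closure_eq ⟨fun v => ⟨fun t ht => ?_, ?_⟩, fun v x => ?_⟩
  · rw [hA t ht]
    exact (isFieldOnExp_fieldOp _).mem_domain v
  · exact IntegrableOn.congr_fun ((fieldVecCLM v).integrable_comp hint)
      (fun t ht => (hexp v t ht).symm) measurableSet_Icc
  · obtain ⟨x, hx1, hx2⟩ := x
    change _ = ⟪expVec v, ∫ t in Set.Icc 0 T, φ t • applyOrZero (A t) x⟫_ℂ
    rw [← integral_inner hx2, ← fieldVecCLM_apply,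
      ← ContinuousLinearMap.integral_comp_comm _ hint, ← inner_conj_symm,
      ← integral_inner ((fieldVecCLM v).integrable_comp hint), ← integral_conj]
    refine setIntegral_congr_fun measurableSet_Icc fun t ht => ?_
    have hm : x ∈ (fieldOp (h t)).domain := by
      rw [← hA t ht]
      exact hx1 t ht
    have h1 := (isFieldOnExp_fieldOp (h t)).inner_eq v ⟨x, hm⟩
    simp only [inner_conj_symm]
    rw [Complex.coe_smul, map_smul, hA t ht, applyOrZero, dif_pos hm, ← Complex.coe_smul, ← Complex.coe_smul,
      inner_smul_left, inner_smul_right, ← h1, Complex.conj_ofReal, fieldVecCLM_apply]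

end FieldOperators

/-! ### Amplifications -/

section Amplification

variable {ι : Type} {H : Type} [NormedAddCommGroup H] [InnerProductSpace ℂ H]

variable (ι H) in
/-- The Hilbert sum of copies of `H`. -/
abbrev Amplified : Type := lp (fun _ : ι => H) 2

/-- The diagonal action of a bounded operator on the Hilbert sum. -/
def amplify (X : H →L[ℂ] H) : Amplified ι H →L[ℂ] Amplified ι H :=
  lp.mapCLM 2 (fun _ => X) (norm_nonneg X) fun _ => le_rfl

lemma amplify_apply (X : H →L[ℂ] H) (ξ : Amplified ι H) (i : ι) : amplify X ξ i = X (ξ i) := rfl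

lemma amplify_one (ξ : Amplified ι H) : amplify 1 ξ = ξ := rfl

lemma amplify_mul (X Y : H →L[ℂ] H) (ξ : Amplified ι H) :
    amplify (X * Y) ξ = amplify X (amplify Y ξ) := rfl

lemma amplify_smul (c : ℂ) (X : H →L[ℂ] H) (ξ : Amplified ι H) :
    amplify (c • X) ξ = c • amplify X ξ := rfl

/-- The embedding `h ↦ h ⊗ conj a`. -/
def tensorConj (a : lp (fun _ : ι => ℂ) 2) : H →L[ℂ] Amplified ι H :=
  LinearMap.mkContinuous
    { toFun := fun h => lp.mapCLM 2 (fun _ => ContinuousLinearMap.toSpanSingleton ℂ h)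
        (norm_nonneg h) (fun _ => (ContinuousLinearMap.norm_toSpanSingleton h).le) (star a)
      map_add' := fun x y => by
        ext i
        simp
      map_smul' := fun c x => by
        ext i
        exact smul_comm (star (a i)) c x } ‖a‖ fun h => by
    have h1 := ContinuousLinearMap.le_of_opNorm_le _ (lp.norm_mapCLM_le 2
      (fun _ : ι => ContinuousLinearMap.toSpanSingleton ℂ h) (norm_nonneg h)
      fun _ => (ContinuousLinearMap.norm_toSpanSingleton h).le) (star a)
    rw [norm_star, mul_comm] at h1
    exact h1

lemma tensorConj_apply (a : lp (fun _ : ι => ℂ) 2) (h : H) (i : ι) :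
    tensorConj a h i = starRingEnd ℂ (a i) • h := rfl

lemma hasSum_norm_inner_sq {κ : Type*} (b : HilbertBasis κ ℂ H) (x : H) :
    HasSum (fun i => ‖⟪b i, x⟫_ℂ‖ ^ 2) (‖x‖ ^ 2) := by
  have h := b.hasSum_inner_mul_inner x x
  have h1 := Complex.hasSum_re h
  rw [inner_self_eq_norm_sq_to_K] at h1
  convert h1 using 1
  · funext i
    rw [← inner_conj_symm x (b i), ← Complex.normSq_eq_conj_mul_self, Complex.ofReal_re,
      Complex.normSq_eq_norm_sq]
  · norm_cast

variable [CompleteSpace H]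

lemma inner_amplify_left (X : H →L[ℂ] H) (ξ ζ : Amplified ι H) :
    ⟪amplify X ξ, ζ⟫_ℂ = ⟪ξ, amplify (ContinuousLinearMap.adjoint X) ζ⟫_ℂ := by
  rw [lp.inner_eq_tsum, lp.inner_eq_tsum]
  refine tsum_congr fun i => ?_
  rw [amplify_apply, amplify_apply, ContinuousLinearMap.adjoint_inner_right]

/-- The partial contraction of a vector of the Hilbert sum with `y`, in a Hilbert basis. -/
def contract (b : HilbertBasis ι ℂ H) (y : H) : Amplified ι H →L[ℂ] H :=
  ContinuousLinearMap.adjoint (tensorConj (b.repr y))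

/-- In the tensor picture, `amplify X` acts on one factor and the contraction on the other. -/
lemma contract_amplify (b : HilbertBasis ι ℂ H) (y : H) (X : H →L[ℂ] H) (ξ : Amplified ι H) :
    contract b y (amplify X ξ) = X (contract b y ξ) := by
  refine ext_inner_left ℂ fun h => ?_
  rw [contract, ContinuousLinearMap.adjoint_inner_right,
    ← ContinuousLinearMap.adjoint_inner_left X, ContinuousLinearMap.adjoint_inner_right]
  rw [← ContinuousLinearMap.adjoint_adjoint X, ← inner_amplify_left,
    ContinuousLinearMap.adjoint_adjoint]
  congr 1
  ext i
  rw [amplify_apply, tensorConj_apply, tensorConj_apply, map_smul]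

lemma hasSum_inner_contract (b : HilbertBasis ι ℂ H) (h y : H) (ξ : Amplified ι H) :
    HasSum (fun i => ⟪b i, y⟫_ℂ * ⟪h, ξ i⟫_ℂ) ⟪h, contract b y ξ⟫_ℂ := by
  rw [contract, ContinuousLinearMap.adjoint_inner_right]
  have e : (fun i => ⟪b i, y⟫_ℂ * ⟪h, ξ i⟫_ℂ) = fun i => ⟪tensorConj (b.repr y) h i, ξ i⟫_ℂ := by
    funext i
    rw [tensorConj_apply, inner_smul_left, Complex.conj_conj, b.repr_apply_apply]
  rw [e]
  exact lp.hasSum_inner (𝕜 := ℂ) _ _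

/-- A purification of a density operator: `ρ = Q²` with `Q` self-adjoint, and the vectors `Q b i`
of a Hilbert basis form a vector of the Hilbert sum. -/
structure IsPurification (ρ Q : H →L[ℂ] H) (b : HilbertBasis ι ℂ H) (ψ : Amplified ι H) : Prop where
  mul_self : Q * Q = ρ
  isSelfAdjoint : IsSelfAdjoint Q
  apply_eq : ∀ i, ψ i = Q (b i)

/-- Take `Q = √ρ`: then `∑ ‖Q b_i‖² = ∑ ⟪b_i, ρ b_i⟫` is the trace, so `Q` is Hilbert–Schmidt. -/
lemma IsDensityOperator.exists_purification {ρ : H →L[ℂ] H} (hρ : IsDensityOperator ρ) :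
    ∃ (ι : Type) (b : HilbertBasis ι ℂ H) (Q : H →L[ℂ] H) (ψ : Amplified ι H),
      IsPurification ρ Q b ψ := by
  obtain ⟨w, b, -⟩ := exists_hilbertBasis ℂ H
  have h0 : 0 ≤ ρ := (ContinuousLinearMap.nonneg_iff_isPositive ρ).mpr hρ.isPositive
  have hsa : IsSelfAdjoint (CFC.sqrt ρ) := (CFC.sqrt_nonneg ρ).isSelfAdjoint
  have hmul : CFC.sqrt ρ * CFC.sqrt ρ = ρ := CFC.sqrt_mul_sqrt_self ρ h0
  have hmem : Memℓp (fun i => CFC.sqrt ρ (b i)) 2 := by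
    obtain ⟨hd, hs⟩ := hρ.trace_eq_one
    refine memℓp_gen ?_
    have h1 := (Complex.hasSum_re (hs w b)).summable
    refine h1.congr fun i => ?_
    have h2 : ⟪b i, ofBounded 1 ⟨ρ (b i), hd (b i)⟩⟫_ℂ = ((‖CFC.sqrt ρ (b i)‖ ^ 2 : ℝ) : ℂ) := by
      change ⟪b i, ρ (b i)⟫_ℂ = _
      conv_lhs => rw [← hmul, mul_apply_eq_comp, ← ContinuousLinearMap.adjoint_inner_left,
        hsa.adjoint_eq, inner_self_eq_norm_sq_to_K]
      norm_cast
    rw [h2, Complex.ofReal_re]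
    simp
  exact ⟨w, b, CFC.sqrt ρ, ⟨_, hmem⟩, hmul, hsa, fun i => rfl⟩

namespace IsPurification

variable {ρ Q : H →L[ℂ] H} {b : HilbertBasis ι ℂ H} {ψ : Amplified ι H}
  (hψ : IsPurification ρ Q b ψ)

include hψ

lemma inner_map_left (x y : H) : ⟪Q x, y⟫_ℂ = ⟪x, Q y⟫_ℂ := by
  rw [← ContinuousLinearMap.adjoint_inner_left, hψ.isSelfAdjoint.adjoint_eq]

/-- A vector `ξ` of the Hilbert sum is the Hilbert–Schmidt operator `b_i ↦ ξ_i`, and `contract b y`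
evaluates it at `y`. For `ψ` this operator is `Q`. -/
lemma contract_eq (y : H) : contract b y ψ = Q y := by
  refine ext_inner_left ℂ fun h => ?_
  refine (hasSum_inner_contract b h y ψ).unique ?_
  have h1 := b.hasSum_inner_mul_inner (Q h) y
  rw [hψ.inner_map_left] at h1
  have e : (fun i => ⟪b i, y⟫_ℂ * ⟪h, ψ i⟫_ℂ) = fun i => ⟪Q h, b i⟫_ℂ * ⟪b i, y⟫_ℂ := by
    funext i
    rw [hψ.apply_eq, hψ.inner_map_left, mul_comm]
  rwa [e]

/-- Read as operators, this is `Tr (ζ Q) = ⟪Q, ζ⟫` in the Hilbert–Schmidt inner product. The basis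
`b'` is arbitrary because `HasExpectation` tests all bases. -/
lemma hasSum_inner_contract {κ : Type*} (b' : HilbertBasis κ ℂ H) (ζ : Amplified ι H) :
    HasSum (fun i => ⟪b' i, contract b (Q (b' i)) ζ⟫_ℂ) ⟪ψ, ζ⟫_ℂ := by
  have hsq : ∀ ξ : Amplified ι H, Summable fun p : ι × κ => ‖⟪b' p.2, ξ p.1⟫_ℂ‖ ^ 2 := by
    intro ξ
    refine (summable_prod_of_nonneg fun p => by positivity).mpr ⟨fun j => ?_, ?_⟩
    · exact (hasSum_norm_inner_sq b' (ξ j)).summable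
    · have h1 := (lp.memℓp ξ).summable (by simp)
      refine h1.congr fun j => ?_
      rw [(hasSum_norm_inner_sq b' (ξ j)).tsum_eq]
      simp
  -- Absolute summability of the double family, from `2 |a b| ≤ |a|² + |b|²` and Parseval, permits
  -- summing in either order.
  have hs : Summable fun p : ι × κ => ⟪ψ p.1, b' p.2⟫_ℂ * ⟪b' p.2, ζ p.1⟫_ℂ := by
    refine Summable.of_norm_bounded ((hsq ψ).add (hsq ζ)) fun p => ?_
    rw [norm_mul, norm_inner_symm]
    nlinarith [sq_nonneg (‖⟪b' p.2, ψ p.1⟫_ℂ‖ - ‖⟪b' p.2, ζ p.1⟫_ℂ‖),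
      sq_nonneg (‖⟪b' p.2, ψ p.1⟫_ℂ‖ + ‖⟪b' p.2, ζ p.1⟫_ℂ‖)]
  have h1 : HasSum (fun p : ι × κ => ⟪ψ p.1, b' p.2⟫_ℂ * ⟪b' p.2, ζ p.1⟫_ℂ) ⟪ψ, ζ⟫_ℂ := by
    have h2 := hs.hasSum.prod_fiberwise fun j => b'.hasSum_inner_mul_inner (ψ j) (ζ j)
    rw [(lp.hasSum_inner (𝕜 := ℂ) ψ ζ).unique h2]
    exact hs.hasSum
  have h3 := (Equiv.prodComm κ ι).hasSum_iff.mpr h1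
  refine h3.prod_fiberwise fun i => ?_
  convert QKL.hasSum_inner_contract b (b' i) (Q (b' i)) ζ using 2 with j
  change ⟪ψ j, b' i⟫_ℂ * _ = _
  rw [hψ.apply_eq, hψ.inner_map_left]
  rfl

/-- The hypothesis says `A ρ = ζ Q` with `ζ` Hilbert–Schmidt, so `A ρ` has the trace `⟪Q, ζ⟫` even
for unbounded `A`. -/
lemma hasExpectation {A : H →ₗ.[ℂ] H} {ζ : Amplified ι H}
    (h : ∀ y, (ρ y, contract b (Q y) ζ) ∈ A.graph) : HasExpectation ρ A ⟪ψ, ζ⟫_ℂ := by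
  refine ⟨fun y => LinearPMap.mem_domain_of_mem_graph (h y), fun κ b' => ?_⟩
  convert hψ.hasSum_inner_contract b' ζ using 3 with i
  exact A.mem_graph_snd_inj (A.mem_graph _) (h (b' i)) rfl

lemma hasExpectation_ofBounded (X : H →L[ℂ] H) :
    HasExpectation ρ (ofBounded X) ⟪ψ, amplify X ψ⟫_ℂ := by
  refine hψ.hasExpectation fun y => ?_
  rw [contract_amplify, hψ.contract_eq, ← mul_apply_eq_comp Q Q, hψ.mul_self]
  exact (ofBounded X).mem_graph ⟨ρ y, Submodule.mem_top⟩

lemma inner_amplify_eq {X : H →L[ℂ] H} {c : ℂ} (h : HasExpectation ρ (ofBounded X) c) :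
    ⟪ψ, amplify X ψ⟫_ℂ = c := by
  obtain ⟨h1, h2⟩ := h
  obtain ⟨h3, h4⟩ := hψ.hasExpectation_ofBounded X
  exact (h4 ι b).unique (h2 ι b)

end IsPurification

lemma starProjection_comm {E : Type*} [NormedAddCommGroup E] [InnerProductSpace ℂ E]
    [CompleteSpace E] (V : Submodule ℂ E) [V.HasOrthogonalProjection] (X : E →L[ℂ] E)
    (h : ∀ x ∈ V, X x ∈ V) (h' : ∀ x ∈ V, ContinuousLinearMap.adjoint X x ∈ V) (x : E) :
    V.starProjection (X x) = X (V.starProjection x) := by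
  refine Submodule.eq_starProjection_of_mem_orthogonal
    (h _ (Submodule.starProjection_apply_mem V x)) ?_
  rw [← map_sub]
  intro y hy
  rw [← ContinuousLinearMap.adjoint_inner_left]
  exact Submodule.sub_starProjection_mem_orthogonal x _ (h' y hy)

/-- The density step of the bicommutant theorem. The closed span `V` is invariant under the
amplified `S` and its adjoints, so its projection commutes with them. The matrix entries of the
projection therefore lie in the commutant of `S` and commute with `A`. Hence `amplify A` preserves
`V`, which contains `ψ`. -/
lemma amplify_mem_closure_span {S : Set (H →L[ℂ] H)} (h1 : 1 ∈ S)
    (hmul : ∀ X ∈ S, ∀ Y ∈ S, ∃ c : ℂ, ∃ Z ∈ S, X * Y = c • Z)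
    (hadj : ∀ X ∈ S, ContinuousLinearMap.adjoint X ∈ S) {A : H →L[ℂ] H}
    (hA : A ∈ Set.centralizer (Set.centralizer S)) (ψ : Amplified ι H) :
    amplify A ψ ∈ (Submodule.span ℂ ((fun X => amplify X ψ) '' S)).topologicalClosure := by
  classical
  set V := (Submodule.span ℂ ((fun X => amplify X ψ) '' S)).topologicalClosure with hV
  have hinv : ∀ X ∈ S, ∀ x ∈ V, amplify X x ∈ V := by
    intro X hX
    have h2 : Set.MapsTo (amplify X) (Submodule.span ℂ ((fun X => amplify X ψ) '' S) : Set (Amplified ι H))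
        (Submodule.span ℂ ((fun X => amplify X ψ) '' S) : Set (Amplified ι H)) := by
      have h3 : Submodule.span ℂ ((fun X => amplify X ψ) '' S) ≤
          (Submodule.span ℂ ((fun X => amplify X ψ) '' S)).comap
            (amplify X).toLinearMap := by
        refine Submodule.span_le.mpr ?_
        rintro _ ⟨Y, hY, rfl⟩
        obtain ⟨c, Z, hZ, hXY⟩ := hmul X hX Y hY
        simp only [Submodule.comap_coe, Set.mem_preimage, SetLike.mem_coe,
          ContinuousLinearMap.coe_coe]
        rw [← amplify_mul, hXY, amplify_smul]
        exact Submodule.smul_mem _ _ (Submodule.subset_span ⟨Z, hZ, rfl⟩)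
      exact fun x hx => h3 hx
    intro x hx
    exact h2.closure (amplify X).continuous hx
  have hadj' : ∀ X : H →L[ℂ] H, ContinuousLinearMap.adjoint (amplify (ι := ι) X) =
      amplify (ContinuousLinearMap.adjoint X) := fun X =>
    ((ContinuousLinearMap.eq_adjoint_iff _ _).mpr fun x y => by
      rw [inner_amplify_left, ContinuousLinearMap.adjoint_adjoint]).symm
  have : CompleteSpace V := (Submodule.isClosed_topologicalClosure _).completeSpace_coe
  have hcomm : ∀ X ∈ S, ∀ x, V.starProjection (amplify X x) = amplify X (V.starProjection x) :=
    fun X hX x => starProjection_comm V (amplify X) (hinv X hX)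
      (by rw [hadj']; exact hinv _ (hadj X hX)) x
  let entry : ι → ι → (H →L[ℂ] H) := fun i j => (lp.evalCLM ℂ (fun _ : ι => H) 2 i).comp
    (V.starProjection.comp (lp.singleContinuousLinearMap ℂ (fun _ : ι => H) 2 j))
  have hsingle : ∀ (X : H →L[ℂ] H) (j : ι) (h : H),
      amplify X (lp.single 2 j h : Amplified ι H) = lp.single 2 j (X h) := by
    intro X j h
    ext i
    rw [amplify_apply, lp.single_apply, lp.single_apply]
    exact Pi.apply_single (fun _ => X) (fun _ => map_zero X) j h i
  have hentry : ∀ i j, entry i j ∈ Set.centralizer S := by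
    intro i j X hX
    ext h
    change X (V.starProjection (lp.single 2 j h) i) = V.starProjection (lp.single 2 j (X h)) i
    rw [← hsingle, hcomm X hX, amplify_apply]
  -- Commutation may be checked entrywise, on vectors with a single nonzero coordinate.
  have hAcomm : V.starProjection.comp (amplify A) = (amplify A).comp V.starProjection := by
    refine lp.ext_continuousLinearMap (by simp) fun j => ?_
    ext h i
    change V.starProjection (amplify A (lp.single 2 j h)) i = A (V.starProjection (lp.single 2 j h) i)
    rw [hsingle]
    exact congrArg (fun f : H →L[ℂ] H => f h) (hA (entry i j) (hentry i j))
  have hψ : ψ ∈ V := Submodule.le_topologicalClosure _ (Submodule.subset_span ⟨1, h1, rfl⟩)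
  have h2 := congrArg (fun f => f ψ) hAcomm
  simp only [ContinuousLinearMap.comp_apply] at h2
  rw [Submodule.starProjection_eq_self_iff.mpr hψ] at h2
  rw [← h2]
  exact Submodule.starProjection_apply_mem V _

lemma inner_amplify_of_mem_bicommutant {S : Set (H →L[ℂ] H)} (h1 : 1 ∈ S)
    (hmul : ∀ X ∈ S, ∀ Y ∈ S, ∃ c : ℂ, ∃ Z ∈ S, X * Y = c • Z)
    (hadj : ∀ X ∈ S, ContinuousLinearMap.adjoint X ∈ S) {A : H →L[ℂ] H}
    (hA : A ∈ Set.centralizer (Set.centralizer S)) {ψ φ : Amplified ι H} {c : ℂ}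
    (h : ∀ X ∈ S, ⟪φ, amplify X ψ⟫_ℂ = c * ⟪ψ, amplify X ψ⟫_ℂ) :
    ⟪φ, amplify A ψ⟫_ℂ = c * ⟪ψ, amplify A ψ⟫_ℂ := by
  have h2 : ∀ x ∈ Submodule.span ℂ ((fun X => amplify X ψ) '' S), ⟪φ, x⟫_ℂ = c * ⟪ψ, x⟫_ℂ := by
    intro x hx
    refine Submodule.span_induction (p := fun x _ => ⟪φ, x⟫_ℂ = c * ⟪ψ, x⟫_ℂ) ?_ ?_ ?_ ?_ hx
    · rintro _ ⟨X, hX, rfl⟩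
      exact h X hX
    · simp
    · intro x y _ _ hx hy
      rw [inner_add_right, inner_add_right, hx, hy, mul_add]
    · intro r x _ hx
      rw [inner_smul_right, inner_smul_right, hx]
      ring
  have h3 : IsClosed {x : Amplified ι H | ⟪φ, x⟫_ℂ = c * ⟪ψ, x⟫_ℂ} :=
    isClosed_eq (by fun_prop) (by fun_prop)
  exact closure_minimal h2 h3 (amplify_mem_closure_span h1 hmul hadj hA ψ)

/-- A vector state which factorizes over generating families of unitary groups factorizes over
the generated von Neumann algebras. -/
lemma inner_amplify_prod {S Y : ℕ → Set (H →L[ℂ] H)} {ψ : Amplified ι H} (hψ : ⟪ψ, ψ⟫_ℂ = 1)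
    (h1 : ∀ n, 1 ∈ S n) (hmul : ∀ n, ∀ X ∈ S n, ∀ Z ∈ S n, ∃ c : ℂ, ∃ W ∈ S n, X * Z = c • W)
    (hadj : ∀ n, ∀ X ∈ S n, ContinuousLinearMap.adjoint X ∈ S n) (hY : ∀ n, 1 ∈ Y n)
    (hcomm : ∀ n, ∀ y ∈ Y (n + 1), ∀ X ∈ S n, X * y = y * X)
    (hYS : ∀ n, ∀ y ∈ Y (n + 1), ∀ X ∈ S n, y * X ∈ Y n)
    (hfac : ∀ n, ∀ y ∈ Y (n + 1), ∀ X ∈ S n,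
      ⟪ψ, amplify (y * X) ψ⟫_ℂ = ⟪ψ, amplify y ψ⟫_ℂ * ⟪ψ, amplify X ψ⟫_ℂ)
    {A : ℕ → H →L[ℂ] H} (hA : ∀ n, A n ∈ Set.centralizer (Set.centralizer (S n))) (N : ℕ) :
    ⟪ψ, amplify ((List.range N).map A).prod ψ⟫_ℂ =
      ∏ k ∈ Finset.range N, ⟪ψ, amplify (A k) ψ⟫_ℂ := by
  -- The extra right factor `y`, taken from the group elements independent of the first `N`
  -- families, lets the induction absorb generators.
  suffices h : ∀ N, ∀ y ∈ Y N, ⟪ψ, amplify (((List.range N).map A).prod * y) ψ⟫_ℂ =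
      (∏ k ∈ Finset.range N, ⟪ψ, amplify (A k) ψ⟫_ℂ) * ⟪ψ, amplify y ψ⟫_ℂ by
    have h2 := h N 1 (hY N)
    rwa [mul_one, amplify_one, hψ, mul_one] at h2
  intro N
  induction N with
  | zero =>
    intro y _
    simp
  | succ n ih =>
    intro y hy
    have hyA : A n * y = y * A n := (hA n y fun X hX => hcomm n y hy X hX).symm
    have hB : ∀ B X : H →L[ℂ] H, ⟪ψ, amplify (B * X) ψ⟫_ℂ =
        ⟪amplify (ContinuousLinearMap.adjoint B) ψ, amplify X ψ⟫_ℂ := by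
      intro B X
      rw [inner_amplify_left, ContinuousLinearMap.adjoint_adjoint, amplify_mul]
    rw [List.range_succ, List.map_append, List.prod_append, List.map_singleton,
      List.prod_singleton, mul_assoc, hyA, ← mul_assoc, hB, Finset.prod_range_succ]
    -- With everything left of `A n` moved into the bra, it suffices to test `X ∈ S n` in place of
    -- `A n`. Then `y * X ∈ Y n` and the induction hypothesis applies.
    rw [inner_amplify_of_mem_bicommutant (h1 n) (hmul n) (hadj n) (hA n)
      (c := (∏ k ∈ Finset.range n, ⟪ψ, amplify (A k) ψ⟫_ℂ) * ⟪ψ, amplify y ψ⟫_ℂ)]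
    · ring
    · intro X hX
      rw [← hB, mul_assoc, ih _ (hYS n y hy X hX), hfac n y hy X hX, mul_assoc]

end Amplification

/-! ### The one-particle vectors of the Karhunen-Loeve coefficients -/

section OneParticleVectors

open Set

variable {d : ℕ}

lemma complexForm_smul (r : ℝ) (x : EuclideanSpace ℝ (Fin 2 × Fin d)) :
    complexForm (r • x) = r • complexForm x := by
  ext j
  simp only [complexForm, PiLp.smul_apply, smul_eq_mul, Complex.ofReal_mul, Complex.real_smul]
  ring

lemma complexForm_zero : complexForm (0 : EuclideanSpace ℝ (Fin 2 × Fin d)) = 0 := by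
  ext j
  simp [complexForm]

/-- The complex form of the unit vector of a channel. -/
def channel (a : Fin 2 × Fin d) : EuclideanSpace ℂ (Fin d) :=
  complexForm (EuclideanSpace.single a (1 : ℝ))

/-- Position channels become `e_j` and momentum channels `i e_j`; the inner products of `1` and `i`
produce the identity and the symplectic part of `Ω`. -/
lemma inner_channel (a b : Fin 2 × Fin d) : ⟪channel a, channel b⟫_ℂ = Omega d a b := by
  obtain ⟨i, j⟩ := a
  obtain ⟨i', j'⟩ := b
  have h : ∀ (i : Fin 2) (j l : Fin d), channel (i, j) l =
      if l = j then (if i = 0 then 1 else Complex.I) else 0 := by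
    intro i j l
    fin_cases i <;> by_cases hl : l = j <;> simp [channel, complexForm, hl]
  simp only [PiLp.inner_apply, RCLike.inner_apply, h, Omega, J, bJ]
  by_cases hj : j = j'
  · subst hj
    rw [Finset.sum_eq_single j (fun l _ hl => by simp [hl]) (by simp)]
    fin_cases i <;> fin_cases i' <;> simp
  · rw [Finset.sum_eq_zero fun l _ => by
      by_cases hl : l = j
      · have : l ≠ j' := fun h => hj (hl.symm.trans h)
        simp [this]
      · simp [hl]]
    simp [hj]

/-- The one-particle vector of `φ e_a` on `[0, T]`. -/
def bandVec (T : ℝ) (φ : ℝ → ℝ) (a : Fin 2 × Fin d) : OneParticle d :=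
  testVec ((Icc 0 T).indicator fun s => φ s • EuclideanSpace.single a (1 : ℝ))

lemma complexForm_indicator (T : ℝ) (φ : ℝ → ℝ) (a : Fin 2 × Fin d) :
    (fun t => complexForm ((Icc 0 T).indicator
      (fun s => φ s • EuclideanSpace.single a (1 : ℝ)) t)) =
      (Icc 0 T).indicator fun s => φ s • channel a := by
  funext t
  by_cases ht : t ∈ Icc 0 T
  · rw [indicator_of_mem ht, indicator_of_mem ht, complexForm_smul]
    rfl
  · rw [indicator_of_notMem ht, indicator_of_notMem ht, complexForm_zero]

lemma memLp_band (T : ℝ) {φ : ℝ → ℝ} (hφ : Continuous φ) (a : Fin 2 × Fin d) :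
    MemLp (fun t => complexForm ((Icc 0 T).indicator
      (fun s => φ s • EuclideanSpace.single a (1 : ℝ)) t)) 2 (volume.restrict (Ici (0 : ℝ))) := by
  rw [complexForm_indicator, memLp_indicator_iff_restrict measurableSet_Icc,
    Measure.restrict_restrict measurableSet_Icc]
  have hc : Continuous fun s => φ s • channel a := by fun_prop
  obtain ⟨C, hC⟩ := (isCompact_Icc (a := 0) (b := T)).exists_bound_of_continuousOn hc.continuousOn
  have : IsFiniteMeasure (volume.restrict (Icc 0 T ∩ Ici 0)) :=
    ⟨by
      rw [Measure.restrict_apply_univ]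
      exact (measure_mono inter_subset_left).trans_lt measure_Icc_lt_top⟩
  refine MemLp.of_bound hc.aestronglyMeasurable C ?_
  filter_upwards [ae_restrict_mem (measurableSet_Icc.inter measurableSet_Ici)] with s hs
  exact hC s hs.1

lemma coeFn_bandVec (T : ℝ) {φ : ℝ → ℝ} (hφ : Continuous φ) (a : Fin 2 × Fin d) :
    bandVec T φ a =ᵐ[volume.restrict (Ici (0 : ℝ))]
      (Icc 0 T).indicator fun s => φ s • channel a := by
  rw [bandVec, testVec, dif_pos (memLp_band T hφ a), ← complexForm_indicator]
  exact MemLp.coeFn_toLp _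

lemma restrict_Icc_restrict_Ici (T : ℝ) :
    (volume.restrict (Ici (0 : ℝ))).restrict (Icc 0 T) = volume.restrict (Icc 0 T) := by
  rw [Measure.restrict_restrict measurableSet_Icc, inter_eq_left.mpr fun x hx => hx.1]

lemma inner_bandVec (w : OneParticle d) (T : ℝ) {φ : ℝ → ℝ} (hφ : Continuous φ)
    (a : Fin 2 × Fin d) :
    ⟪w, bandVec T φ a⟫_ℂ = ∫ s in Icc 0 T, (φ s : ℂ) * ⟪w s, channel a⟫_ℂ := by
  rw [L2.inner_def, ← restrict_Icc_restrict_Ici, ← integral_indicator measurableSet_Icc]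
  refine integral_congr_ae ?_
  filter_upwards [coeFn_bandVec T hφ a] with s hs
  rw [hs]
  by_cases h : s ∈ Icc 0 T
  · rw [indicator_of_mem h, indicator_of_mem h, ← Complex.coe_smul, inner_smul_right]
  · rw [indicator_of_notMem h, indicator_of_notMem h, inner_zero_right]

lemma inner_bandVec_bandVec (T : ℝ) {φ χ : ℝ → ℝ} (hφ : Continuous φ) (hχ : Continuous χ)
    (a b : Fin 2 × Fin d) :
    ⟪bandVec T φ a, bandVec T χ b⟫_ℂ = ((∫ s in Icc 0 T, φ s * χ s : ℝ) : ℂ) * Omega d a b := by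
  rw [inner_bandVec _ T hχ, ← integral_complex_ofReal, ← integral_mul_const]
  refine integral_congr_ae ?_
  have h1 := ae_restrict_of_ae (s := Icc 0 T) (coeFn_bandVec T hφ a)
  rw [restrict_Icc_restrict_Ici] at h1
  filter_upwards [h1, ae_restrict_mem measurableSet_Icc] with s hs hm
  rw [hs, indicator_of_mem hm, ← Complex.coe_smul, inner_smul_left, Complex.conj_ofReal,
    inner_channel]
  push_cast
  ring

lemma continuous_bandVec_one (a : Fin 2 × Fin d) :
    Continuous fun t => bandVec t (fun _ => 1) a := by
  have hμ : ∀ t, (volume.restrict (Ici (0 : ℝ))) (Icc 0 t) ≠ ⊤ := fun t =>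
    ((Measure.restrict_apply_le _ _).trans_lt measure_Icc_lt_top).ne
  have e : (fun t => bandVec t (fun _ => 1) a) = fun t =>
      indicatorConstLp 2 measurableSet_Icc (hμ t) (channel a) := by
    funext t
    refine Lp.ext ?_
    filter_upwards [coeFn_bandVec t continuous_const a,
      indicatorConstLp_coeFn (p := 2) (hs := measurableSet_Icc) (hμs := hμ t) (c := channel a)]
      with s h1 h2
    rw [h1, h2]
    simp
  rw [e]
  refine continuous_of_continuous_inner ?_
  -- The Brownian kernel `min s t`; the maximum with `0` covers negative times, where the interval
  -- is empty.
  have h : ∀ p : ℝ × ℝ, ⟪indicatorConstLp 2 measurableSet_Icc (hμ p.1) (channel a),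
      indicatorConstLp 2 measurableSet_Icc (hμ p.2) (channel a)⟫_ℂ =
        (max (min p.1 p.2) 0 : ℝ) • ⟪channel a, channel a⟫_ℂ := by
    intro p
    rw [L2.inner_indicatorConstLp_indicatorConstLp _ _ (hμ p.1) (hμ p.2), Icc_inter_Icc, sup_idem, measureReal_def,
      Measure.restrict_apply measurableSet_Icc, inter_eq_left.mpr fun x hx => hx.1,
      Real.volume_Icc, sub_zero, ENNReal.toReal_ofReal']
  simp only [h]
  fun_prop

/-- `W_a(t) - I` is a field operator. -/
lemma W_sub_idOp (a : Fin 2 × Fin d) (t : ℝ) :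
    W a t - idOp d = fieldOp (bandVec t (fun _ => 1) a) := by
  have h : wienerIntegral t (fun _ => EuclideanSpace.single a (1 : ℝ)) =
      fieldOp (bandVec t (fun _ => 1) a) := by
    simp only [wienerIntegral, bandVec, one_smul]
  rw [W, h]
  set A := fieldOp (bandVec t (fun _ => 1) a)
  refine LinearPMap.ext ?_ ?_
  · ext x
    simp [idOp, ofBounded, LinearPMap.sub_domain, LinearPMap.add_domain]
  · intro x hx hx'
    change (1 : FieldSpace d →L[ℂ] FieldSpace d) x + A ⟨x, _⟩ -
      (1 : FieldSpace d →L[ℂ] FieldSpace d) x = A ⟨x, _⟩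
    exact add_sub_cancel_left _ _

/-- Integration by parts in weak form: Fubini on the triangle `0 ≤ s ≤ t ≤ T`. -/
lemma inner_bandVec_primitive (w : OneParticle d) {T : ℝ} {φ : ℝ → ℝ} (hφ : Continuous φ)
    (a : Fin 2 × Fin d) : ⟪w, bandVec T (fun s => ∫ t in s..T, φ t) a⟫_ℂ =
      ∫ t in Icc 0 T, (φ t : ℂ) * ⟪w, bandVec t (fun _ => 1) a⟫_ℂ := by
  have hΦ : Continuous fun s => ∫ t in s..T, φ t := by
    have h : (fun s => ∫ t in s..T, φ t) = fun s => -∫ t in T..s, φ t := by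
      funext s
      rw [intervalIntegral.integral_symm]
    rw [h]
    exact (intervalIntegral.continuous_primitive (fun a b => hφ.intervalIntegrable a b) T).neg
  rw [inner_bandVec w T hΦ]
  have hw : IntegrableOn (fun s => ⟪w s, channel a⟫_ℂ) (Icc 0 T) := by
    have h1 := L2.integrable_inner (𝕜 := ℂ) w (bandVec T (fun _ => 1) a)
    have h2 := h1.integrableOn (s := Icc 0 T)
    rw [IntegrableOn, restrict_Icc_restrict_Ici] at h2
    refine h2.congr ?_
    have h3 := ae_restrict_of_ae (s := Icc 0 T) (coeFn_bandVec T continuous_const (φ := fun _ => 1) a)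
    rw [restrict_Icc_restrict_Ici] at h3
    filter_upwards [h3, ae_restrict_mem measurableSet_Icc] with s hs hm
    rw [hs, indicator_of_mem hm, one_smul]
  have hφi : IntegrableOn (fun t => (φ t : ℂ)) (Icc 0 T) :=
    (Complex.continuous_ofReal.comp hφ).continuousOn.integrableOn_compact isCompact_Icc
  have hle : MeasurableSet {p : ℝ × ℝ | p.2 ≤ p.1} := measurableSet_le measurable_snd measurable_fst
  have hprod := (Integrable.mul_prod hφi hw).indicator hle
  have hswap := integral_integral_swap
    (f := fun t s => {p : ℝ × ℝ | p.2 ≤ p.1}.indicator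
      (fun z => (φ z.1 : ℂ) * ⟪w z.2, channel a⟫_ℂ) (t, s)) hprod
  have hL : ∀ t ∈ Icc 0 T, (φ t : ℂ) * ⟪w, bandVec t (fun _ => 1) a⟫_ℂ = ∫ s in Icc 0 T,
      {p : ℝ × ℝ | p.2 ≤ p.1}.indicator (fun z => (φ z.1 : ℂ) * ⟪w z.2, channel a⟫_ℂ) (t, s) := by
    intro t ht
    rw [inner_bandVec w t continuous_const,
      ← integral_const_mul, ← integral_indicator measurableSet_Icc,
      ← integral_indicator measurableSet_Icc]
    congr 1
    funext s
    by_cases hs : s ∈ Icc 0 t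
    · have hs' : s ∈ Icc 0 T := ⟨hs.1, hs.2.trans ht.2⟩
      rw [indicator_of_mem hs, indicator_of_mem hs', indicator_of_mem (by exact hs.2)]
      simp
    · rw [indicator_of_notMem hs]
      by_cases hs' : s ∈ Icc 0 T
      · rw [indicator_of_mem hs', indicator_of_notMem
          (show (t, s) ∉ {p : ℝ × ℝ | p.2 ≤ p.1} from fun h => hs ⟨hs'.1, h⟩)]
      · rw [indicator_of_notMem hs']
  have hR : ∀ s ∈ Icc 0 T, (∫ t in Icc 0 T, {p : ℝ × ℝ | p.2 ≤ p.1}.indicator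
      (fun z => (φ z.1 : ℂ) * ⟪w z.2, channel a⟫_ℂ) (t, s)) =
        ((∫ t in s..T, φ t : ℝ) : ℂ) * ⟪w s, channel a⟫_ℂ := by
    intro s hs
    rw [intervalIntegral.integral_of_le hs.2, ← integral_Icc_eq_integral_Ioc,
      ← integral_complex_ofReal, ← integral_mul_const, ← integral_indicator measurableSet_Icc,
      ← integral_indicator measurableSet_Icc]
    congr 1
    funext t
    by_cases ht : t ∈ Icc s T
    · have ht' : t ∈ Icc 0 T := ⟨hs.1.trans ht.1, ht.2⟩
      rw [indicator_of_mem ht, indicator_of_mem ht', indicator_of_mem (by exact ht.1)]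
    · rw [indicator_of_notMem ht]
      by_cases ht' : t ∈ Icc 0 T
      · rw [indicator_of_mem ht', indicator_of_notMem
          (show (t, s) ∉ {p : ℝ × ℝ | p.2 ≤ p.1} from fun h => ht ⟨h, ht'.2⟩)]
      · rw [indicator_of_notMem ht']
  rw [setIntegral_congr_fun measurableSet_Icc hL, hswap]
  exact (setIntegral_congr_fun measurableSet_Icc hR).symm

/-- The cosine functions `√(2 / T) cos (ω_k t)`. -/
def cosfun (T : ℝ) (k : ℕ) (t : ℝ) : ℝ := √(2 / T) * Real.cos (omega T k * t)

lemma continuous_cosfun (T : ℝ) (k : ℕ) : Continuous (cosfun T k) := by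
  unfold cosfun
  fun_prop

lemma continuous_eigenfun (T : ℝ) (k : ℕ) : Continuous (eigenfun T k) := by
  unfold eigenfun
  fun_prop

lemma omega_pos {T : ℝ} (hT : 0 < T) (k : ℕ) : 0 < omega T k := by
  unfold omega
  have := Real.pi_pos
  positivity

/-- The boundary term at `T` vanishes because `ω_k T = (k + 1/2) π`, which is the role of the
half-integer shift. -/
lemma integral_eigenfun {T : ℝ} (hT : 0 < T) (k : ℕ) (s : ℝ) :
    omega T k * ∫ t in s..T, eigenfun T k t = cosfun T k s := by
  have h0 : Real.cos (omega T k * T) = 0 := by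
    rw [Real.cos_eq_zero_iff]
    refine ⟨k, ?_⟩
    unfold omega
    field_simp
    push_cast
    ring
  have h1 : ∀ t ∈ uIcc s T, HasDerivAt (fun t => -(√(2 / T) * Real.cos (omega T k * t)))
      (omega T k * eigenfun T k t) t := by
    intro t _
    have h2 := ((((hasDerivAt_id t).const_mul (omega T k)).cos).const_mul √(2 / T)).neg
    have e : -(√(2 / T) * (-Real.sin (omega T k * t) * (omega T k * 1))) =
        omega T k * eigenfun T k t := by
      unfold eigenfun
      ring
    rw [← e]
    exact h2
  rw [← intervalIntegral.integral_const_mul, intervalIntegral.integral_eq_sub_of_hasDerivAt h1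
    ((continuous_const.mul (continuous_eigenfun T k)).intervalIntegrable _ _), h0]
  simp [cosfun]

lemma integral_cos_pi_mul {T : ℝ} (hT : 0 < T) {n : ℤ} (hn : n ≠ 0) :
    ∫ t in (0 : ℝ)..T, Real.cos (Real.pi / T * n * t) = 0 := by
  have hn' : (n : ℝ) ≠ 0 := by exact_mod_cast hn
  have hc : Real.pi / T * n ≠ 0 := by
    have := Real.pi_ne_zero
    positivity
  rw [intervalIntegral.integral_comp_mul_left (fun x => Real.cos x) hc, integral_cos]
  have h : Real.pi / T * n * T = n * Real.pi := by
    field_simp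
  rw [h, Real.sin_int_mul_pi]
  simp

/-- The product formula gives frequencies `(j - k) π / T` and `(j + k + 1) π / T`. The second is
never zero, the first only for `j = k`. -/
lemma integral_cosfun_mul {T : ℝ} (hT : 0 < T) (j k : ℕ) :
    ∫ s in Icc 0 T, cosfun T j s * cosfun T k s = if j = k then 1 else 0 := by
  rw [integral_Icc_eq_integral_Ioc, ← intervalIntegral.integral_of_le hT.le]
  have h1 : ∀ s, cosfun T j s * cosfun T k s =
      T⁻¹ * (Real.cos (Real.pi / T * ((j - k : ℤ) : ℝ) * s) +
        Real.cos (Real.pi / T * ((j + k + 1 : ℤ) : ℝ) * s)) := by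
    intro s
    have e1 : Real.pi / T * ((j - k : ℤ) : ℝ) * s = omega T j * s - omega T k * s := by
      unfold omega
      push_cast
      ring
    have e2 : Real.pi / T * ((j + k + 1 : ℤ) : ℝ) * s = omega T j * s + omega T k * s := by
      unfold omega
      push_cast
      ring
    have e3 : √(2 / T) * √(2 / T) = 2 * T⁻¹ := by
      rw [Real.mul_self_sqrt (by positivity), div_eq_mul_inv]
    rw [e1, e2, Real.cos_sub, Real.cos_add]
    unfold cosfun
    linear_combination (Real.cos (omega T j * s) * Real.cos (omega T k * s)) * e3
  have hc : ∀ n : ℤ, IntervalIntegrable (fun s => Real.cos (Real.pi / T * (n : ℝ) * s)) volume 0 T :=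
    fun n => (by fun_prop : Continuous fun s => Real.cos (Real.pi / T * (n : ℝ) * s)).intervalIntegrable
      _ _
  simp only [h1]
  rw [intervalIntegral.integral_const_mul, intervalIntegral.integral_add (hc _) (hc _),
    integral_cos_pi_mul hT (n := j + k + 1) (by positivity)]
  split_ifs with h
  · subst h
    simp [hT.ne']
  · rw [integral_cos_pi_mul hT (sub_ne_zero.mpr (by exact_mod_cast h))]
    simp

/-- The one-particle vector of the Karhunen-Loeve coefficient. -/
def klVec (T : ℝ) (k : ℕ) (a : Fin 2 × Fin d) : OneParticle d := bandVec T (cosfun T k) a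

/-- Equality of unbounded operators, domains included: the coefficient is the Wiener integral of a
cosine. -/
lemma klCoeff_eq_fieldOp {T : ℝ} (hT : 0 < T) (k : ℕ) (a : Fin 2 × Fin d) :
    klCoeff T k a = fieldOp (klVec T k a) := by
  rw [klCoeff, strongIntegral_fieldOp (continuous_eigenfun T k)
    (continuous_bandVec_one a).continuousOn (fun t _ => W_sub_idOp a t)
    (fun w => inner_bandVec_primitive w (continuous_eigenfun T k) a), smul_fieldOp (omega_pos hT k).ne']
  congr 1
  have hΦ : Continuous fun s => ∫ t in s..T, eigenfun T k t := by
    have h : (fun s => ∫ t in s..T, eigenfun T k t) = fun s => (omega T k)⁻¹ * cosfun T k s := by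
      funext s
      rw [← integral_eigenfun hT, inv_mul_cancel_left₀ (omega_pos hT k).ne']
    rw [h]
    exact continuous_const.mul (continuous_cosfun T k)
  refine ext_inner_left ℂ fun w => ?_
  rw [klVec, inner_bandVec w T (continuous_cosfun T k), inner_smul_right,
    inner_bandVec w T hΦ, ← integral_const_mul]
  refine setIntegral_congr_fun measurableSet_Icc fun s _ => ?_
  simp only [← integral_eigenfun hT k s]
  push_cast
  ring

lemma inner_klVec {T : ℝ} (hT : 0 < T) (j k : ℕ) (a b : Fin 2 × Fin d) :
    ⟪klVec T j a, klVec T k b⟫_ℂ = if j = k then Omega d a b else 0 := by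
  rw [klVec, klVec, inner_bandVec_bandVec T (continuous_cosfun T j) (continuous_cosfun T k),
    integral_cosfun_mul hT]
  split_ifs <;> simp

end OneParticleVectors

/-! ### Vacuum states on a subspace of the one-particle space -/

section VacuumStates

variable {K : Type} [NormedAddCommGroup K] [InnerProductSpace ℂ K]

lemma weyl_mul (u v : K) : weyl u * weyl v =
    Complex.exp (-Complex.I * ((⟪u, v⟫_ℂ).im : ℂ)) • weyl (u + v) :=
  ContinuousLinearMap.ext fun x => weyl_weyl u v x

lemma adjoint_weyl (u : K) : ContinuousLinearMap.adjoint (weyl u) = weyl (-u) := by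
  symm
  refine (ContinuousLinearMap.eq_adjoint_iff _ _).mpr fun x y => ?_
  have h1 : weyl u (weyl (-u) x) = x := by
    rw [weyl_weyl, inner_neg_right, Complex.neg_im, add_neg_cancel, weyl_zero]
    have h0 : (⟪u, u⟫_ℂ).im = 0 := inner_self_im (𝕜 := ℂ) u
    rw [h0]
    simp
  have h2 := LinearIsometry.inner_map_map
    (⟨(weyl u : Fock K →ₗ[ℂ] Fock K), norm_weyl u⟩ : Fock K →ₗᵢ[ℂ] Fock K) (weyl (-u) x) y
  rw [← h2]
  change ⟪weyl u (weyl (-u) x), weyl u y⟫_ℂ = _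
  rw [h1]

lemma weyl_mul_of_inner_eq_zero {u v : K} (h : ⟪u, v⟫_ℂ = 0) : weyl u * weyl v = weyl (u + v) := by
  rw [weyl_mul, h]
  simp

lemma weyl_commute_of_inner_eq_zero {u v : K} (h : ⟪u, v⟫_ℂ = 0) :
    weyl u * weyl v = weyl v * weyl u := by
  rw [weyl_mul_of_inner_eq_zero h, weyl_mul_of_inner_eq_zero (inner_eq_zero_symm.mp h), add_comm]

/-! ### The Fock space of a subspace embedded through a vacuum vector -/

variable {ι : Type}

/-- The vector state of `ψ` restricts to the vacuum state on the Weyl operators of `L`. -/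
def IsVacuumVector (L : Submodule ℂ K) (ψ : Amplified ι (Fock K)) : Prop :=
  ∀ u ∈ L, ⟪ψ, amplify (weyl u) ψ⟫_ℂ = Complex.exp (-(‖u‖ ^ 2 : ℝ) / 2)

variable {L : Submodule ℂ K} {ψ : Amplified ι (Fock K)}

/-- The vector which corresponds to the exponential vector of `u`. -/
def coherentVec (L : Submodule ℂ K) (ψ : Amplified ι (Fock K)) (u : L) : Amplified ι (Fock K) :=
  Complex.exp ((‖u‖ ^ 2 : ℝ) / 2) • amplify (weyl (u : K)) ψ

/-- The Weyl relations and the vacuum functional determine the Gram matrix, so it is that of the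
exponential vectors. This makes `vacuumEmbedding` well defined and isometric. -/
lemma IsVacuumVector.inner_coherentVec (hψ : IsVacuumVector L ψ) (u v : L) :
    ⟪coherentVec L ψ u, coherentVec L ψ v⟫_ℂ = Complex.exp ⟪u, v⟫_ℂ := by
  have h1 := hψ (-u + v) (L.add_mem (L.neg_mem u.2) v.2)
  rw [coherentVec, coherentVec, inner_smul_left, inner_smul_right, inner_amplify_left, adjoint_weyl,
    ← amplify_mul, weyl_mul, amplify_smul, inner_smul_right, h1, ← Complex.exp_conj,
    ← Complex.exp_add, ← Complex.exp_add, ← Complex.exp_add]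
  congr 1
  have h2 := @norm_add_sq ℂ K _ _ _ (-(u : K)) v
  have h3 := Complex.re_add_im ⟪(u : K), (v : K)⟫_ℂ
  rw [h2, norm_neg, inner_neg_left, Submodule.coe_inner]
  simp only [map_div₀, Complex.conj_ofReal, map_ofNat, RCLike.re_eq_complex_re, Complex.neg_re,
    Complex.neg_im, Submodule.coe_norm]
  push_cast
  linear_combination h3

/-- The isometric embedding of the Fock space of `L` which maps the vacuum to `ψ`. -/
def vacuumEmbedding (L : Submodule ℂ K) (ψ : Amplified ι (Fock K)) :
    Fock L →L[ℂ] Amplified ι (Fock K) :=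
  (Finsupp.linearCombination ℂ (coherentVec L ψ)).extendOfNorm
    (Finsupp.linearCombination ℂ (expVec : L → Fock L))

namespace IsVacuumVector

variable (hψ : IsVacuumVector L ψ)

include hψ

lemma norm_linearCombination (f : L →₀ ℂ) :
    ‖Finsupp.linearCombination ℂ (coherentVec L ψ) f‖ =
      ‖Finsupp.linearCombination ℂ (expVec : L → Fock L) f‖ := by
  have h : ⟪Finsupp.linearCombination ℂ (coherentVec L ψ) f,
      Finsupp.linearCombination ℂ (coherentVec L ψ) f⟫_ℂ =
      ⟪Finsupp.linearCombination ℂ (expVec : L → Fock L) f,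
        Finsupp.linearCombination ℂ (expVec : L → Fock L) f⟫_ℂ := by
    simp only [Finsupp.linearCombination_apply, Finsupp.sum, sum_inner, inner_sum,
      inner_smul_left, inner_smul_right, hψ.inner_coherentVec, inner_expVec]
  rw [← sq_eq_sq₀ (norm_nonneg _) (norm_nonneg _), ← inner_self_eq_norm_sq (𝕜 := ℂ), h,
    inner_self_eq_norm_sq (𝕜 := ℂ)]

lemma vacuumEmbedding_linearCombination (f : L →₀ ℂ) :
    vacuumEmbedding L ψ (Finsupp.linearCombination ℂ (expVec : L → Fock L) f) =
      Finsupp.linearCombination ℂ (coherentVec L ψ) f :=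
  LinearMap.extendOfNorm_eq denseRange_expVec
    ⟨1, fun f => by rw [one_mul, hψ.norm_linearCombination]⟩ f

lemma vacuumEmbedding_expVec (u : L) :
    vacuumEmbedding L ψ (expVec u) = coherentVec L ψ u := by
  simpa using hψ.vacuumEmbedding_linearCombination (Finsupp.single u 1)

lemma vacuumEmbedding_zero : vacuumEmbedding L ψ (expVec 0) = ψ := by
  rw [hψ.vacuumEmbedding_expVec, coherentVec]
  simp [weyl_zero, amplify_one]

lemma norm_vacuumEmbedding (x : Fock L) : ‖vacuumEmbedding L ψ x‖ = ‖x‖ := by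
  refine (denseRange_expVec (K := L)).induction_on
    (p := fun x => ‖vacuumEmbedding L ψ x‖ = ‖x‖) x ?_ ?_
  · exact isClosed_eq (by fun_prop) (by fun_prop)
  · intro f
    rw [hψ.vacuumEmbedding_linearCombination, hψ.norm_linearCombination]

lemma inner_vacuumEmbedding (x y : Fock L) :
    ⟪vacuumEmbedding L ψ x, vacuumEmbedding L ψ y⟫_ℂ = ⟪x, y⟫_ℂ :=
  LinearIsometry.inner_map_map (⟨(vacuumEmbedding L ψ : Fock L →ₗ[ℂ] Amplified ι (Fock K)),
    hψ.norm_vacuumEmbedding⟩ : Fock L →ₗᵢ[ℂ] Amplified ι (Fock K)) x y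

lemma vacuumEmbedding_weyl (u : L) (x : Fock L) :
    vacuumEmbedding L ψ (weyl u x) = amplify (weyl (u : K)) (vacuumEmbedding L ψ x) := by
  have h : (vacuumEmbedding L ψ).comp (weyl u) =
      (amplify (weyl (u : K))).comp (vacuumEmbedding L ψ) := by
    refine fock_clm_ext fun v => ?_
    simp only [ContinuousLinearMap.comp_apply]
    rw [weyl_expVec, map_smul, hψ.vacuumEmbedding_expVec, hψ.vacuumEmbedding_expVec, coherentVec,
      coherentVec, map_smul, ← amplify_mul, weyl_mul, amplify_smul, smul_smul, smul_smul,
      ← Complex.exp_add, ← Complex.exp_add]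
    congr 2
    have h2 := @norm_add_sq ℂ L _ _ _ u v
    have h3 := Complex.re_add_im ⟪(u : K), (v : K)⟫_ℂ
    rw [h2, Submodule.coe_inner]
    simp only [RCLike.re_eq_complex_re]
    push_cast
    linear_combination h3
  exact congrArg (fun f => f x) h

/-- The partial contractions of the embedding intertwine the field operators. -/
lemma contract_mem_fieldOp_graph (b : HilbertBasis ι ℂ (Fock K)) (y : Fock K) {h : L}
    {x z : Fock L} (hx : (x, z) ∈ (fieldOp h).graph) :
    (contract b y (vacuumEmbedding L ψ x), contract b y (vacuumEmbedding L ψ z)) ∈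
      (fieldOp (h : K)).graph := by
  rw [fieldOp, mem_generator_graph] at hx ⊢
  -- A bounded map that intertwines the two Weyl groups carries derivatives of orbits to derivatives
  -- of orbits.
  have h1 := (((contract b y).comp (vacuumEmbedding L ψ)).restrictScalars
    ℝ).hasFDerivAt.comp_hasDerivAt 0 hx
  have e : (fun s : ℝ => weyl (((s : ℂ) * Complex.I) • (h : K))
      (contract b y (vacuumEmbedding L ψ x))) =
      (((contract b y).comp (vacuumEmbedding L ψ)).restrictScalars ℝ) ∘
        fun s : ℝ => weyl (((s : ℂ) * Complex.I) • h) x := by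
    funext s
    change _ = contract b y (vacuumEmbedding L ψ (weyl (((s : ℂ) * Complex.I) • h) x))
    rw [hψ.vacuumEmbedding_weyl, contract_amplify]
    rfl
  rw [e]
  have e2 : Complex.I • contract b y (vacuumEmbedding L ψ z) =
      (((contract b y).comp (vacuumEmbedding L ψ)).restrictScalars ℝ) (Complex.I • z) :=
    (map_smul ((contract b y).comp (vacuumEmbedding L ψ)) Complex.I z).symm
  rw [e2]
  exact h1

end IsVacuumVector

lemma fieldVec_zero (h : K) : fieldVec h 0 = creationVec h 0 := by
  simp [fieldVec]

lemma mem_opMul_graph {H : Type} [NormedAddCommGroup H] [InnerProductSpace ℂ H]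
    {A B : H →ₗ.[ℂ] H} {x y z : H} (hxy : (x, y) ∈ B.graph) (hyz : (y, z) ∈ A.graph) :
    (x, z) ∈ (opMul A B).graph := by
  obtain ⟨x', rfl, rfl⟩ := (LinearPMap.mem_graph_iff _).mp hxy
  obtain ⟨y', hy', rfl⟩ := (LinearPMap.mem_graph_iff _).mp hyz
  have hm : B x' ∈ A.domain := by
    rw [← show (y' : H) = B x' from hy']
    exact y'.2
  refine (LinearPMap.mem_graph_iff _).mpr ⟨⟨x', ⟨x', hm, rfl⟩⟩, rfl, ?_⟩
  change A ⟨B x', _⟩ = A y'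
  congr 1
  exact Subtype.ext hy'.symm

/-! ### Moments, Gaussian law and independence in a vacuum state -/

section Expectations

variable {ρ Q : Fock K →L[ℂ] Fock K} {b : HilbertBasis ι ℂ (Fock K)}
  (hp : IsPurification ρ Q b ψ) (hψ : IsVacuumVector L ψ)

include hp hψ

/-- Contracting the image `ψ` of the vacuum with `Q y` gives `Q (Q y) = ρ y`. This supplies the
domain condition of `HasExpectation`. -/
lemma contract_vacuum_mem_graph (h : L) (y : Fock K) :
    (ρ y, contract b (Q y) (vacuumEmbedding L ψ (creationVec h 0))) ∈ (fieldOp (h : K)).graph := by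
  have h1 := hψ.contract_mem_fieldOp_graph b (Q y) (expVec_mem_fieldOp_graph h 0)
  rw [hψ.vacuumEmbedding_zero, hp.contract_eq, ← mul_apply_eq_comp Q Q, hp.mul_self,
    fieldVec_zero] at h1
  exact h1

lemma hasExpectation_fieldOp (h : L) : HasExpectation ρ (fieldOp (h : K)) 0 := by
  have h1 := hp.hasExpectation (contract_vacuum_mem_graph hp hψ h)
  have h2 := hψ.inner_vacuumEmbedding (expVec 0) (creationVec h 0)
  rw [hψ.vacuumEmbedding_zero, inner_creationVec_right, inner_zero_left, zero_mul] at h2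
  rwa [h2] at h1

lemma hasExpectation_opMul_fieldOp (g h : L) :
    HasExpectation ρ (opMul (fieldOp (g : K)) (fieldOp (h : K))) ⟪(g : K), (h : K)⟫_ℂ := by
  obtain ⟨z, hz⟩ := LinearPMap.mem_domain_iff.mp (creationVec_zero_mem_fieldOp_domain h g)
  have h1 : HasExpectation ρ (opMul (fieldOp (g : K)) (fieldOp (h : K)))
      ⟪ψ, vacuumEmbedding L ψ z⟫_ℂ := hp.hasExpectation fun y => mem_opMul_graph
    (contract_vacuum_mem_graph hp hψ h y) (hψ.contract_mem_fieldOp_graph b (Q y) hz)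
  have h2 : ⟪ψ, vacuumEmbedding L ψ z⟫_ℂ = ⟪(g : K), (h : K)⟫_ℂ := by
    have h3 := hψ.inner_vacuumEmbedding (expVec 0) z
    rw [hψ.vacuumEmbedding_zero] at h3
    -- Here `z` is the field operator of `g` applied to `a(h)*` of the vacuum. Symmetry moves it to
    -- the other side, leaving `⟪a(g)* vac, a(h)* vac⟫ = ⟪g, h⟫`.
    have h4 := (isUnitaryGroup_weyl g).inner_graph hz (expVec_mem_fieldOp_graph g 0)
    rw [fieldVec_zero, inner_creationVec_creationVec] at h4
    rw [h3, ← h4, Submodule.coe_inner]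
    simp
  rwa [h2] at h1

/-- Field operators of finitely many vectors are jointly Gaussian in a vacuum state, with the Gram
matrix of the vectors as the covariance matrix. -/
lemma isJointlyGaussian_fieldOp {κ : Type} [Fintype κ] {η : κ → K} (hη : ∀ a, η a ∈ L)
    {Γ : Matrix κ κ ℂ} (hΓ : ∀ a b, ⟪η a, η b⟫_ℂ = Γ a b) :
    IsJointlyGaussian ρ (fun a => fieldOp (η a)) 0 Γ := by
  have hin : ∀ u v : κ → ℝ, ⟪Complex.I • ∑ a, (u a : ℂ) • η a, Complex.I • ∑ a, (v a : ℂ) • η a⟫_ℂ =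
      ∑ a, ∑ b, (u a : ℂ) * Γ a b * (v b : ℂ) := by
    intro u v
    rw [inner_smul_left, inner_smul_right, Complex.conj_I, ← mul_assoc, neg_mul, Complex.I_mul_I,
      neg_neg, one_mul, sum_inner]
    refine Finset.sum_congr rfl fun a _ => ?_
    rw [inner_sum]
    refine Finset.sum_congr rfl fun b _ => ?_
    rw [inner_smul_left, inner_smul_right, hΓ, Complex.conj_ofReal]
    ring
  constructor
  · intro u v
    rw [linComb_fieldOp, linComb_fieldOp, linComb_fieldOp, expI_fieldOp, expI_fieldOp, expI_fieldOp,
      weyl_mul, hin, ← smul_add, ← Finset.sum_add_distrib]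
    congr 2
    · congr 2
      rw [Complex.im_sum]
      push_cast
      refine Finset.sum_congr rfl fun a _ => ?_
      rw [Complex.im_sum]
      push_cast
      refine Finset.sum_congr rfl fun b _ => ?_
      simp
    · congr 1
      refine Finset.sum_congr rfl fun a _ => ?_
      rw [← add_smul, Pi.add_apply, Complex.ofReal_add]
  · intro u
    rw [linComb_fieldOp, expI_fieldOp]
    have h1 := hψ (Complex.I • ∑ a, (u a : ℂ) • η a)
      (L.smul_mem _ (L.sum_mem fun a _ => L.smul_mem _ (hη a)))
    have h2 := hp.hasExpectation_ofBounded (weyl (Complex.I • ∑ a, (u a : ℂ) • η a))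
    rw [h1] at h2
    convert h2 using 2
    have h3 := inner_self_eq_norm_sq_to_K (𝕜 := ℂ) (Complex.I • ∑ a, (u a : ℂ) • η a)
    rw [← hin, h3]
    simp
    ring

/-- Field operators of mutually orthogonal families of vectors are independent in a vacuum
state. -/
lemma statIndependent_fieldOp {κ : Type} [Fintype κ] {η : ℕ → κ → K} (hη : ∀ k a, η k a ∈ L)
    (horth : ∀ j k, j ≠ k → ∀ a b, ⟪η j a, η k b⟫_ℂ = 0) :
    StatIndependent ρ fun k a => fieldOp (η k a) := by
  let vec : ℕ → (κ → ℝ) → K := fun k u => Complex.I • ∑ a, (u a : ℂ) • η k a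
  have hvecL : ∀ k u, vec k u ∈ L := fun k u =>
    L.smul_mem _ (L.sum_mem fun a _ => L.smul_mem _ (hη k a))
  have hvec_add : ∀ k u v, vec k u + vec k v = vec k (u + v) := by
    intro k u v
    simp only [vec, ← smul_add, ← Finset.sum_add_distrib, ← add_smul, Pi.add_apply,
      Complex.ofReal_add]
  have hvec_neg : ∀ k u, -vec k u = vec k (-u) := by
    intro k u
    simp [vec]
  have hvec_zero : ∀ k, vec k 0 = 0 := by
    intro k
    simp [vec]
  have hinner : ∀ k u w, (∀ a, ⟪w, η k a⟫_ℂ = 0) → ⟪w, vec k u⟫_ℂ = 0 := by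
    intro k u w hw
    simp only [vec, inner_smul_right, inner_sum, hw]
    simp
  have hvec_orth : ∀ j k, j ≠ k → ∀ u v, ⟪vec j u, vec k v⟫_ℂ = 0 := fun j k hjk u v =>
    hinner k v _ fun a => inner_eq_zero_symm.mp
      (hinner j u _ fun b => horth k j hjk.symm a b)
  let S : ℕ → Set (Fock K →L[ℂ] Fock K) := fun k => Set.range fun u => weyl (vec k u)
  have hgen : ∀ k, generatedAlgebra (fun a => fieldOp (η k a)) =
      Set.centralizer (Set.centralizer (S k)) := by
    intro k
    simp only [generatedAlgebra, linComb_fieldOp, expI_fieldOp, S, vec]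
  have hψ1 : ⟪ψ, ψ⟫_ℂ = 1 := by
    have h := hψ 0 L.zero_mem
    rw [weyl_zero, amplify_one] at h
    simpa using h
  refine ⟨fun j k hjk A hA B hB => ?_, fun N A hA => ?_⟩
  · rw [hgen] at hA hB
    have h1 : S k ⊆ Set.centralizer (S j) := by
      rintro _ ⟨v, rfl⟩ _ ⟨u, rfl⟩
      exact weyl_commute_of_inner_eq_zero (hvec_orth j k hjk u v)
    -- From `S k ⊆ (S j)'` follows `(S j)'' ⊆ (S k)'`, which commutes with `(S k)''`.
    exact hB A (Set.centralizer_subset h1 hA)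
  · simp only [hgen] at hA
    refine ⟨fun k => ⟪ψ, amplify (A k) ψ⟫_ℂ, fun k => hp.hasExpectation_ofBounded (A k), ?_⟩
    -- `Y n` consists of the Weyl operators of vectors of `L` orthogonal to the families with index
    -- below `n`. Orthogonality makes the Weyl phases trivial and the squared norms additive, hence
    -- the factorization.
    rw [← inner_amplify_prod (S := S)
      (Y := fun n => {X | ∃ u ∈ L, (∀ k < n, ∀ a, ⟪u, η k a⟫_ℂ = 0) ∧ X = weyl u}) hψ1 ?_ ?_ ?_ ?_ ?_
      ?_ ?_ hA N]
    · exact hp.hasExpectation_ofBounded _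
    · exact fun n => ⟨0, by simp only [hvec_zero, weyl_zero]⟩
    · rintro n _ ⟨u, rfl⟩ _ ⟨v, rfl⟩
      exact ⟨_, _, ⟨u + v, rfl⟩, by rw [weyl_mul, hvec_add]⟩
    · rintro n _ ⟨u, rfl⟩
      exact ⟨-u, by rw [adjoint_weyl, hvec_neg]⟩
    · exact fun n => ⟨0, L.zero_mem, fun k _ a => inner_zero_left _, weyl_zero.symm⟩
    · rintro n _ ⟨w, -, hw, rfl⟩ _ ⟨u, rfl⟩
      exact (weyl_commute_of_inner_eq_zero (hinner n u w (hw n n.lt_succ_self))).symm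
    · rintro n _ ⟨w, hwL, hw, rfl⟩ _ ⟨u, rfl⟩
      refine ⟨w + vec n u, L.add_mem hwL (hvecL n u), fun k hk a => ?_,
        weyl_mul_of_inner_eq_zero (hinner n u w (hw n n.lt_succ_self))⟩
      rw [inner_add_left, hw k (hk.trans n.lt_succ_self), zero_add]
      exact inner_eq_zero_symm.mp (hinner n u _ fun b => horth k n hk.ne a b)
    · rintro n _ ⟨w, hwL, hw, rfl⟩ _ ⟨u, rfl⟩
      have h0 := hinner n u w (hw n n.lt_succ_self)
      rw [weyl_mul_of_inner_eq_zero h0, hψ _ (L.add_mem hwL (hvecL n u)), hψ _ hwL,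
        hψ _ (hvecL n u), ← Complex.exp_add]
      congr 1
      rw [@norm_add_sq ℂ, h0]
      simp
      ring

end Expectations

end VacuumStates

/-! ### The vacuum state of the quantum Wiener process -/

section WienerVacuum

open Set

variable {d : ℕ}

/-- The real form of a complex vector, the inverse of `complexForm`. -/
def realForm (z : EuclideanSpace ℂ (Fin d)) : EuclideanSpace ℝ (Fin 2 × Fin d) :=
  WithLp.toLp 2 fun p => if p.1 = 0 then (z p.2).re else (z p.2).im

lemma complexForm_realForm (z : EuclideanSpace ℂ (Fin d)) : complexForm (realForm z) = z := by
  ext j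
  simp [complexForm, realForm, mul_comm Complex.I, Complex.re_add_im]

lemma norm_realForm (z : EuclideanSpace ℂ (Fin d)) : ‖realForm z‖ = ‖z‖ := by
  rw [← sq_eq_sq₀ (norm_nonneg _) (norm_nonneg _), EuclideanSpace.norm_sq_eq,
    EuclideanSpace.norm_sq_eq, Fintype.sum_prod_type_right]
  refine Finset.sum_congr rfl fun j _ => ?_
  rw [Fin.sum_univ_two, ← Complex.normSq_eq_norm_sq, Complex.normSq_apply]
  simp [realForm, sq]

lemma continuous_realForm : Continuous (realForm (d := d)) := by
  refine (PiLp.continuous_toLp 2 _).comp (continuous_pi fun p => ?_)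
  by_cases hp : p.1 = 0
  · simp only [hp, if_true]
    fun_prop
  · simp only [hp, if_false]
    fun_prop

/-- The one-particle vectors which are supported in `[0, T]`. -/
def supported (d : ℕ) (T : ℝ) : Submodule ℂ (OneParticle d) where
  carrier := {u | ∀ᵐ t ∂volume.restrict (Ici (0 : ℝ)), t ∉ Icc 0 T → u t = 0}
  add_mem' := fun {u v} hu hv => by
    filter_upwards [hu, hv, Lp.coeFn_add u v] with t h1 h2 h3 ht
    rw [h3, Pi.add_apply, h1 ht, h2 ht, add_zero]
  zero_mem' := by
    filter_upwards [Lp.coeFn_zero (E := EuclideanSpace ℂ (Fin d)) 2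
      (volume.restrict (Ici (0 : ℝ)))] with t ht _
    rw [ht, Pi.zero_apply]
  smul_mem' := fun c u hu => by
    filter_upwards [hu, Lp.coeFn_smul c u] with t h1 h2 ht
    rw [h2, Pi.smul_apply, h1 ht, smul_zero]

lemma bandVec_mem_supported (T : ℝ) {φ : ℝ → ℝ} (hφ : Continuous φ) (a : Fin 2 × Fin d) :
    bandVec T φ a ∈ supported d T := by
  change ∀ᵐ t ∂volume.restrict (Ici (0 : ℝ)), t ∉ Icc 0 T → bandVec T φ a t = 0
  filter_upwards [coeFn_bandVec T hφ a] with t h1 ht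
  rw [h1, indicator_of_notMem ht]

/-- Real `2d`-component test functions exhaust the complex subspace `supported d T`, so the vacuum
hypothesis reaches all of its Weyl operators. -/
lemma exists_testVec_eq {T : ℝ} {u : OneParticle d} (hu : u ∈ supported d T) :
    ∃ f : ℝ → EuclideanSpace ℝ (Fin 2 × Fin d), MemLp f 2 (volume.restrict (Icc 0 T)) ∧
      testVec ((Icc 0 T).indicator f) = u ∧ ∫ t in Icc 0 T, ‖f t‖ ^ 2 = ‖u‖ ^ 2 := by
  have hu' : ∀ᵐ t ∂volume.restrict (Ici (0 : ℝ)), t ∉ Icc 0 T → u t = 0 := hu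
  have hind : (fun t => complexForm ((Icc 0 T).indicator (fun t => realForm (u t)) t)) =ᵐ[
      volume.restrict (Ici (0 : ℝ))] u := by
    filter_upwards [hu'] with t ht
    by_cases h : t ∈ Icc 0 T
    · rw [indicator_of_mem h, complexForm_realForm]
    · rw [indicator_of_notMem h, complexForm_zero, ht h]
  refine ⟨fun t => realForm (u t), ?_, ?_, ?_⟩
  · have h1 := (Lp.memLp u).restrict (Icc 0 T)
    rw [restrict_Icc_restrict_Ici] at h1
    exact h1.of_le (continuous_realForm.comp_aestronglyMeasurable h1.aestronglyMeasurable)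
      (Filter.Eventually.of_forall fun t => (norm_realForm (u t)).le)
  · have hm := (memLp_congr_ae hind).mpr (Lp.memLp u)
    rw [testVec, dif_pos hm]
    exact Lp.ext ((MemLp.coeFn_toLp hm).trans hind)
  · have h1 : ((‖u‖ ^ 2 : ℝ) : ℂ) = ((∫ t in Ici (0 : ℝ), ‖u t‖ ^ 2 : ℝ) : ℂ) := by
      rw [← integral_complex_ofReal]
      have h2 := inner_self_eq_norm_sq_to_K (𝕜 := ℂ) u
      rw [L2.inner_def] at h2
      push_cast
      refine h2.symm.trans (integral_congr_ae (Filter.Eventually.of_forall fun t => ?_))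
      exact inner_self_eq_norm_sq_to_K (𝕜 := ℂ) (u t)
    rw [Complex.ofReal_inj.mp h1, ← restrict_Icc_restrict_Ici, ← integral_indicator measurableSet_Icc]
    refine integral_congr_ae ?_
    filter_upwards [hu'] with t ht
    by_cases h : t ∈ Icc 0 T
    · rw [indicator_of_mem h, norm_realForm]
    · rw [indicator_of_notMem h, ht h]
      simp

lemma IsVacuum.hasExpectation_weyl {T : ℝ} {ρ : FieldSpace d →L[ℂ] FieldSpace d}
    (h : IsVacuum T ρ) {u : OneParticle d} (hu : u ∈ supported d T) :
    HasExpectation ρ (ofBounded (weyl u)) (Complex.exp (-(‖u‖ ^ 2 : ℝ) / 2)) := by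
  -- The factor `-i` cancels the `i` in `expI (fieldOp h) = weyl (i h)`.
  obtain ⟨f, hf, hfu, hn⟩ := exists_testVec_eq ((supported d T).smul_mem (-Complex.I) hu)
  have h1 := h f hf
  rw [wienerIntegral, hfu, expI_fieldOp, smul_smul, hn, norm_smul] at h1
  simp only [norm_neg, Complex.norm_I, one_mul, mul_neg, Complex.I_mul_I, neg_neg, one_smul] at h1
  convert h1 using 2
  ring

end WienerVacuum

end QKL

end

theorem theorem1 (d : ℕ) (T : ℝ) (hT : 0 < T)
    (ρ : QKL.FieldSpace d →L[ℂ] QKL.FieldSpace d) (hρ : QKL.IsDensityOperator ρ)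
    (hvac : QKL.IsVacuum T ρ) :
    QKL.StatIndependent ρ (QKL.klCoeff T) ∧
    (∀ N : ℕ, QKL.IsJointlyGaussian ρ
      (fun p : Fin (N + 1) × (Fin 2 × Fin d) => QKL.klCoeff T (p.1 : ℕ) p.2) 0
      ((1 : Matrix (Fin (N + 1)) (Fin (N + 1)) ℂ) ⊗ₖ QKL.Omega d)) ∧
    (∀ (k : ℕ) (a : Fin 2 × Fin d), QKL.HasExpectation ρ (QKL.klCoeff T k a) 0) ∧
    (∀ (j k : ℕ) (a b : Fin 2 × Fin d),
      QKL.HasExpectation ρ (QKL.opMul (QKL.klCoeff T j a) (QKL.klCoeff T k b))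
        (if j = k then QKL.Omega d a b else 0)) := by
  obtain ⟨ι, b, Q, ψ, hp⟩ := hρ.exists_purification
  have hψ : QKL.IsVacuumVector (QKL.supported d T) ψ := fun u hu =>
    hp.inner_amplify_eq (hvac.hasExpectation_weyl hu)
  have hη : ∀ (k : ℕ) (a : Fin 2 × Fin d), QKL.klVec T k a ∈ QKL.supported d T := fun k a =>
    QKL.bandVec_mem_supported T (QKL.continuous_cosfun T k) a
  have hkl : QKL.klCoeff (d := d) T = fun k a => QKL.fieldOp (QKL.klVec T k a) :=
    funext fun k => funext fun a => QKL.klCoeff_eq_fieldOp hT k a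
  rw [hkl]
  refine ⟨QKL.statIndependent_fieldOp hp hψ hη fun j k hjk a b => ?_, fun N => ?_,
    fun k a => QKL.hasExpectation_fieldOp hp hψ ⟨_, hη k a⟩, fun j k a b => ?_⟩
  · rw [QKL.inner_klVec hT, if_neg hjk]
  · refine QKL.isJointlyGaussian_fieldOp hp hψ
      (η := fun p : Fin (N + 1) × (Fin 2 × Fin d) => QKL.klVec T (p.1 : ℕ) p.2)
      (fun p => hη p.1 p.2) fun p q => ?_
    rw [QKL.inner_klVec hT, Matrix.kroneckerMap_apply, Matrix.one_apply]
    simp only [Fin.ext_iff]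
    split_ifs <;> simp
  · rw [← QKL.inner_klVec hT]
    exact QKL.hasExpectation_opMul_fieldOp hp hψ ⟨_, hη j a⟩ ⟨_, hη k b⟩
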